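/- **Theorem 1.4.** Let $M^n$ be a smooth manifold with a smooth Riemannian metric $g$ and a function $\phi\in C^\infty(M)$; that is, $(M^n,g,\phi,\lambda)$ is a manifold with density with $\lambda=0$. Let $(g_u,\phi_u)$ be a smooth $1$-parameter family of Riemannian metrics and functions on $M$, defined for $(x,u)$ in an open neighbourhood of $M\times\{0\}$ in $M\times\mathbb{R}$, with $(g_0,\phi_0)=(g,\phi)$. Suppose that $$\widetilde g=2\,du\,dv+g_u,\qquad \widetilde\phi=\phi_u-v$$ is a weighted ambient space in normal form for $(M^n,g,\phi,0)$: on a neighbourhood of $\{u=0\}$ in $\mathbb{R}\times M\times\mathbb{R}$, with points $(v,x,u)$, $$\mathrm{Ric}(\widetilde g)+\widetilde\nabla^2\widetilde\phi=O(u^\infty),\qquad \widetilde\Delta\widetilde\phi-|\widetilde\nabla\widetilde\phi|^2_{\widetilde g}=O(u^\infty).$$ Here a function or tensor is $O(u^\infty)$ if it vanishes to infinite order in $u$ at $u=0$. Write $R_u$, $\Delta$, $\nabla_u$ for the scalar curvature, Laplacian and gradient of $g_u$, set $(\mathrm{Ric}_\phi)_u=\mathrm{Ric}(g_u)+\nabla_u^2\phi_u$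 and $(v_{1,\phi})_u=\frac12\left(R_u+2\Delta\phi_u-|\nabla_u\phi_u|^2\right)$, and define the vector field $$X=(v_{1,\phi})_u\,\partial_v-\partial_u .$$ Regard $g_u=(g_u)_{ij}dx^idx^j$ and $(\mathrm{Ric}_\phi)_u$ as $(0,2)$-tensor fields on $\mathbb{R}\times M\times\mathbb{R}$. Then $$L_Xg_u=-2(\mathrm{Ric}_\phi)_u \bmod O(u^\infty),\qquad L_X\widetilde\phi=-(R_u+\Delta\phi_u)\bmod O(u^\infty).$$ In other words, $(g_u,\widetilde\phi)$ is a formal solution of the $\mathcal F$-gradient Ricci flow $\partial_tg=-2\mathrm{Ric}_\phi$, $\partial_t\phi=-R-\Delta\phi$ along $X$. -/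

import Mathlib

open scoped Manifold ContDiff Topology
open Bundle Asymptotics

set_option maxSynthPendingDepth 3

noncomputable section

namespace WeightedAmbient

/-! ### Local (pseudo-)Riemannian geometry

`G : E → E →L[ℝ] E →L[ℝ] ℝ` is the coordinate expression of a (pseudo-)Riemannian metric on a
finite-dimensional real vector space `E`. All formulas only involve the germ of `G` at `y`. -/

section Local

variable {E : Type*} [NormedAddCommGroup E] [NormedSpace ℝ E]

/-- Christoffel symbols of the first kind:
`Γ(a, b; c) = (∂_a G(b, c) + ∂_b G(a, c) - ∂_c G(a, b)) / 2`. -/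
def christoffelFirst (G : E → E →L[ℝ] E →L[ℝ] ℝ) (y : E) : E →L[ℝ] E →L[ℝ] E →L[ℝ] ℝ :=
  let D : E →L[ℝ] E →L[ℝ] E →L[ℝ] ℝ := fderiv ℝ G y
  let S : (E →L[ℝ] E →L[ℝ] ℝ) →L[ℝ] E →L[ℝ] E →L[ℝ] ℝ :=
    (ContinuousLinearMap.flipₗᵢ ℝ E E ℝ).toContinuousLinearEquiv.toContinuousLinearMap
  let D' : E →L[ℝ] E →L[ℝ] E →L[ℝ] ℝ := S ∘L D.flip
  (1 / 2 : ℝ) • (D + D.flip - D')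

theorem christoffelFirst_apply (G : E → E →L[ℝ] E →L[ℝ] ℝ) (y a b c : E) :
    christoffelFirst G y a b c =
      (1 / 2 : ℝ) * (fderiv ℝ G y a b c + fderiv ℝ G y b a c - fderiv ℝ G y c a b) := by
  simp [christoffelFirst]

/-- Raising an index: the inverse of `E → E^*`, `a ↦ A(a, ·)`. -/
def sharp (A : E →L[ℝ] E →L[ℝ] ℝ) : (E →L[ℝ] ℝ) →L[ℝ] E :=
  ContinuousLinearMap.inverse A

/-- Christoffel symbols of the second kind (of the Levi-Civita connection),
`Γ(a, b) = Γ^k_{ij} a^i b^j ∂_k`. -/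
def christoffel (G : E → E →L[ℝ] E →L[ℝ] ℝ) (y : E) : E →L[ℝ] E →L[ℝ] E :=
  (ContinuousLinearMap.compL ℝ E (E →L[ℝ] ℝ) E (sharp (G y))) ∘L christoffelFirst G y

theorem christoffel_apply (G : E → E →L[ℝ] E →L[ℝ] ℝ) (y a b : E) :
    christoffel G y a b = sharp (G y) (christoffelFirst G y a b) := by
  simp [christoffel]

/-- The endomorphism `c ↦ Rm(c, a) b`, where
`Rm(c, a) b = ∇_c ∇_a b - ∇_a ∇_c b` for constant coordinate vectors `a, b, c`. -/
def curvatureEnd (G : E → E →L[ℝ] E →L[ℝ] ℝ) (y a b : E) : E →L[ℝ] E :=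
  ((fderiv ℝ (christoffel G) y).flip a).flip b - (fderiv ℝ (christoffel G) y a).flip b
    + (christoffel G y).flip (christoffel G y a b)
    - (christoffel G y a) ∘L (christoffel G y).flip b

theorem curvatureEnd_apply (G : E → E →L[ℝ] E →L[ℝ] ℝ) (y a b c : E) :
    curvatureEnd G y a b c =
      fderiv ℝ (christoffel G) y c a b - fderiv ℝ (christoffel G) y a c b
        + christoffel G y c (christoffel G y a b) - christoffel G y a (christoffel G y c b) := by
  simp [curvatureEnd]

/-- The Hessian `∇²f(a, b) = ∂_a ∂_b f - df(Γ(a, b))`. -/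
def localHess (G : E → E →L[ℝ] E →L[ℝ] ℝ) (f : E → ℝ) (y : E) : E →L[ℝ] E →L[ℝ] ℝ :=
  fderiv ℝ (fderiv ℝ f) y
    - (ContinuousLinearMap.compL ℝ E E ℝ (fderiv ℝ f y)) ∘L christoffel G y

/-- The squared gradient `|∇f|² = g^{ij} ∂_i f ∂_j f`. -/
def localGradSq (G : E → E →L[ℝ] E →L[ℝ] ℝ) (f : E → ℝ) (y : E) : ℝ :=
  fderiv ℝ f y (sharp (G y) (fderiv ℝ f y))

variable [FiniteDimensional ℝ E]

/-- The Ricci tensor `Ric(a, b) = tr (c ↦ Rm(c, a) b)` (positive on round spheres). -/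
def localRic (G : E → E →L[ℝ] E →L[ℝ] ℝ) (y : E) : E →L[ℝ] E →L[ℝ] ℝ :=
  (LinearMap.mk₂ ℝ (fun a b => LinearMap.trace ℝ E (curvatureEnd G y a b : E →ₗ[ℝ] E))
    (fun a a' b => by
      rw [← map_add]; congr 1; ext c; simp [curvatureEnd_apply]; abel)
    (fun r a b => by
      rw [← map_smul]; congr 1; ext c; simp [curvatureEnd_apply, smul_sub, smul_add])
    (fun a b b' => by
      rw [← map_add]; congr 1; ext c; simp [curvatureEnd_apply]; abel)
    (fun r a b => by
      rw [← map_smul]; congr 1; ext c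
      simp [curvatureEnd_apply, smul_sub, smul_add])).toContinuousBilinearMap

theorem localRic_apply (G : E → E →L[ℝ] E →L[ℝ] ℝ) (y a b : E) :
    localRic G y a b = LinearMap.trace ℝ E (curvatureEnd G y a b : E →ₗ[ℝ] E) := rfl

/-- The trace `g^{ij} B_{ij}` of a bilinear form `B` with respect to the metric `A`. -/
def metricTrace (A B : E →L[ℝ] E →L[ℝ] ℝ) : ℝ :=
  LinearMap.trace ℝ E ((sharp A ∘L B : E →L[ℝ] E) : E →ₗ[ℝ] E)

end Local

/-! ### Tensors on a manifold

`N` is a manifold without boundary with model `I`. A tensor is computed at a point `p` in the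
preferred chart at `p`; Mathlib's tangent space `TangentSpace I p` is the model vector space `E`,
identified with the space of tangent vectors at `p` through this same chart. -/

section Manifold

variable {E : Type*} [NormedAddCommGroup E] [NormedSpace ℝ E]
  {H : Type*} [TopologicalSpace H] (I : ModelWithCorners ℝ E H)
  {N : Type*} [TopologicalSpace N] [ChartedSpace H N]

/-- The coordinate expression of the `(0,2)`-tensor field `h` in the chart at `p`. -/
def tensorInChart (h : (q : N) → TangentSpace I q →L[ℝ] TangentSpace I q →L[ℝ] ℝ) (p : N)
    (y : E) : E →L[ℝ] E →L[ℝ] ℝ :=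
  let L : E →L[ℝ] E := mfderiv 𝓘(ℝ, E) I (extChartAt I p).symm y
  let B : E →L[ℝ] E →L[ℝ] ℝ := h ((extChartAt I p).symm y)
  B.bilinearComp L L

/-- The coordinate expression of the vector field `X` in the chart at `p`. -/
def vectorInChart (X : (q : N) → TangentSpace I q) (p : N) (y : E) : E :=
  mfderiv I 𝓘(ℝ, E) (extChartAt I p) ((extChartAt I p).symm y) (X ((extChartAt I p).symm y))

/-- The Lie derivative `L_X f = df(X)` of a function. -/
def lieDerivFun (X : (q : N) → TangentSpace I q) (f : N → ℝ) (p : N) : ℝ :=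
  mfderiv I 𝓘(ℝ, ℝ) f p (X p)

/-- The Lie derivative of a `(0,2)`-tensor field, in coordinates
`(L_X h)_{ij} = X^k ∂_k h_{ij} + h_{kj} ∂_i X^k + h_{ik} ∂_j X^k`. -/
def lieDerivTensor (X : (q : N) → TangentSpace I q)
    (h : (q : N) → TangentSpace I q →L[ℝ] TangentSpace I q →L[ℝ] ℝ) (p : N) :
    TangentSpace I p →L[ℝ] TangentSpace I p →L[ℝ] ℝ :=
  let y : E := extChartAt I p p
  let h' : E → E →L[ℝ] E →L[ℝ] ℝ := tensorInChart I h p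
  let X' : E → E := vectorInChart I X p
  (fderiv ℝ h' y (X' y)
    + (h' y).bilinearComp (fderiv ℝ X' y) (ContinuousLinearMap.id ℝ E)
    + (h' y).bilinearComp (ContinuousLinearMap.id ℝ E) (fderiv ℝ X' y) : E →L[ℝ] E →L[ℝ] ℝ)

variable (g : (q : N) → TangentSpace I q →L[ℝ] TangentSpace I q →L[ℝ] ℝ)

/-- The Hessian `∇²f`. -/
def hess (f : N → ℝ) (p : N) : TangentSpace I p →L[ℝ] TangentSpace I p →L[ℝ] ℝ :=
  localHess (E := E) (tensorInChart I g p) (f ∘ (extChartAt I p).symm) (extChartAt I p p)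

/-- The squared norm `|∇f|²` of the gradient. -/
def gradSq (f : N → ℝ) (p : N) : ℝ :=
  localGradSq (E := E) (tensorInChart I g p) (f ∘ (extChartAt I p).symm) (extChartAt I p p)

variable [FiniteDimensional ℝ E]

/-- The Ricci tensor. -/
def ric (p : N) : TangentSpace I p →L[ℝ] TangentSpace I p →L[ℝ] ℝ :=
  localRic (E := E) (tensorInChart I g p) (extChartAt I p p)

/-- The scalar curvature `R = tr_g Ric`. -/
def scal (p : N) : ℝ :=
  metricTrace (E := E) (tensorInChart I g p (extChartAt I p p)) (ric I g p)

/-- The Laplacian `Δf = tr_g ∇²f`. -/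
def laplacian (f : N → ℝ) (p : N) : ℝ :=
  metricTrace (E := E) (tensorInChart I g p (extChartAt I p p)) (hess I g f p)

/-- The Bakry-Emery Ricci tensor `Ric_φ = Ric + ∇²φ`. -/
def weightedRic (φ : N → ℝ) (p : N) : TangentSpace I p →L[ℝ] TangentSpace I p →L[ℝ] ℝ :=
  ric I g p + hess I g φ p

/-- `P_φ = Ric_φ - λ g`. -/
def weightedP (φ : N → ℝ) (lam : ℝ) (p : N) :
    TangentSpace I p →L[ℝ] TangentSpace I p →L[ℝ] ℝ :=
  weightedRic I g φ p - lam • g p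

/-- `F_φ = Δφ - |∇φ|² + 2 λ φ - (dim N) λ`. -/
def weightedF (φ : N → ℝ) (lam : ℝ) (p : N) : ℝ :=
  laplacian I g φ p - gradSq I g φ p + 2 * lam * φ p - (Module.finrank ℝ E : ℝ) * lam

/-- `R_φ = R + 2 Δφ - |∇φ|² + 2 λ (φ - dim N)`. -/
def weightedScal (φ : N → ℝ) (lam : ℝ) (p : N) : ℝ :=
  scal I g p + 2 * laplacian I g φ p - gradSq I g φ p
    + 2 * lam * (φ p - (Module.finrank ℝ E : ℝ))

end Manifold

/-! ### The ambient manifold `ℝ × M × ℝ`, with points `(v, x, u)` -/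

/-- The model vector space of an `n`-dimensional manifold. -/
abbrev Model (n : ℕ) : Type := EuclideanSpace ℝ (Fin n)

/-- The model with corners of `ℝ × M × ℝ`, where `M` is an `n`-dimensional manifold. -/
abbrev ambientModel (n : ℕ) :
    ModelWithCorners ℝ (ℝ × Model n × ℝ) (ModelProd ℝ (ModelProd (Model n) ℝ)) :=
  𝓘(ℝ, ℝ).prod ((𝓡 n).prod 𝓘(ℝ, ℝ))

section Ambient

variable {n : ℕ} {M : Type*} [TopologicalSpace M] [ChartedSpace (Model n) M]

/-- A function on (a neighbourhood of `u = 0` in) `ℝ × M × ℝ` is `O(u^∞)` if it is `O(u^m)` for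
every `m`, at every point of `{u = 0}`. For a smooth function this says that all its derivatives
`∂_u^k` vanish at `u = 0`. -/
def FunIsOInf (f : ℝ × M × ℝ → ℝ) : Prop :=
  ∀ (v : ℝ) (x : M) (m : ℕ), (fun u : ℝ => f (v, x, u)) =O[𝓝 0] (fun u : ℝ => u ^ m)

/-- A `(0,2)`-tensor field on (a neighbourhood of `u = 0` in) `ℝ × M × ℝ` is `O(u^∞)` if all its
components are. The tangent space of `ℝ × M × ℝ` at `(v, x, u)` is identified with `ℝ × T_x M × ℝ`;
`a, b` are fixed vectors of the latter. -/
def TensorIsOInf (T : (p : ℝ × M × ℝ) →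
    TangentSpace (ambientModel n) p →L[ℝ] TangentSpace (ambientModel n) p →L[ℝ] ℝ) : Prop :=
  ∀ (v : ℝ) (x : M) (a b : ℝ × Model n × ℝ) (m : ℕ),
    (fun u : ℝ => T (v, x, u) a b) =O[𝓝 0] (fun u : ℝ => u ^ m)

/-- The coordinate one-form `dv`. -/
def dv (n : ℕ) : (ℝ × Model n × ℝ) →L[ℝ] ℝ := ContinuousLinearMap.fst ℝ ℝ (Model n × ℝ)

/-- The differential of the projection `ℝ × M × ℝ → M`. -/
def dx (n : ℕ) : (ℝ × Model n × ℝ) →L[ℝ] Model n :=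
  ContinuousLinearMap.fst ℝ (Model n) ℝ ∘L ContinuousLinearMap.snd ℝ ℝ (Model n × ℝ)

/-- The coordinate one-form `du`. -/
def du (n : ℕ) : (ℝ × Model n × ℝ) →L[ℝ] ℝ :=
  ContinuousLinearMap.snd ℝ (Model n) ℝ ∘L ContinuousLinearMap.snd ℝ ℝ (Model n × ℝ)

/-- A `1`-parameter family `h_u` of `(0,2)`-tensors on `M`, viewed as the tensor field
`(h_u)_{ij} dx^i dx^j` on `ℝ × M × ℝ`. -/
def horizontal (h : ℝ → (x : M) → TangentSpace (𝓡 n) x →L[ℝ] TangentSpace (𝓡 n) x →L[ℝ] ℝ)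
    (p : ℝ × M × ℝ) :
    TangentSpace (ambientModel n) p →L[ℝ] TangentSpace (ambientModel n) p →L[ℝ] ℝ :=
  let B : Model n →L[ℝ] Model n →L[ℝ] ℝ := h p.2.2 p.2.1
  B.bilinearComp (dx n) (dx n)

/-- The metric `2 du dv + g_u`. -/
def ambientMetric (g : ℝ → (x : M) → TangentSpace (𝓡 n) x →L[ℝ] TangentSpace (𝓡 n) x →L[ℝ] ℝ)
    (p : ℝ × M × ℝ) :
    TangentSpace (ambientModel n) p →L[ℝ] TangentSpace (ambientModel n) p →L[ℝ] ℝ :=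
  let B : (ℝ × Model n × ℝ) →L[ℝ] (ℝ × Model n × ℝ) →L[ℝ] ℝ := horizontal g p
  (dv n).smulRight (du n) + (du n).smulRight (dv n) + B

/-- The function `φ_u - v + λ u v`. -/
def ambientPotential (φ : ℝ → M → ℝ) (lam : ℝ) (p : ℝ × M × ℝ) : ℝ :=
  φ p.2.2 p.2.1 - p.1 + lam * p.2.2 * p.1

/-- `(v_{1,φ})_u = R_φ / 2` of `(g_u, φ_u)`, as a function of `u` and `x`. -/
def vOne (g : ℝ → (x : M) → TangentSpace (𝓡 n) x →L[ℝ] TangentSpace (𝓡 n) x →L[ℝ] ℝ)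
    (φ : ℝ → M → ℝ) (lam : ℝ) (u : ℝ) (x : M) : ℝ :=
  (1 / 2) * weightedScal (𝓡 n) (g u) (φ u) lam x

/-- The vector field `X = (v_{1,φ})_u ∂_v - ∂_u`. -/
def flowField (g : ℝ → (x : M) → TangentSpace (𝓡 n) x →L[ℝ] TangentSpace (𝓡 n) x →L[ℝ] ℝ)
    (φ : ℝ → M → ℝ) (lam : ℝ) (p : ℝ × M × ℝ) : TangentSpace (ambientModel n) p :=
  ((vOne g φ lam p.2.2 p.2.1, 0, -1) : ℝ × Model n × ℝ)

variable [IsManifold (𝓡 n) ∞ M]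

/-- A weighted ambient space in normal form for the manifold with density `(M, g₀, φ₀, λ)`:
the metric `2 du dv + g_u` and the function `φ_u - v + λ u v` on a neighbourhood of `{u = 0}` in
`ℝ × M × ℝ`, where `(g_u, φ_u)` is a smooth `1`-parameter family starting at `(g₀, φ₀)`, such that
`P_φ` and `F_φ` of the ambient metric and function are `O(u^∞)`. -/
structure NormalAmbientSpace
    (g₀ : ContMDiffRiemannianMetric (𝓡 n) ∞ (Model n) (fun x : M => TangentSpace (𝓡 n) x))
    (φ₀ : C^∞⟮𝓡 n, M; 𝓘(ℝ, ℝ), ℝ⟯) (lam : ℝ) where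
  /-- The ambient manifold is `{(v, x, u) | (x, u) ∈ W}`. -/
  W : Set (M × ℝ)
  isOpen_W : IsOpen W
  mem_W : ∀ x : M, (x, (0 : ℝ)) ∈ W
  /-- The family `g_u`; its values outside `W` are irrelevant. -/
  g : ℝ → (x : M) → TangentSpace (𝓡 n) x →L[ℝ] TangentSpace (𝓡 n) x →L[ℝ] ℝ
  /-- The family `φ_u`; its values outside `W` are irrelevant. -/
  φ : ℝ → M → ℝ
  symm : ∀ (x : M) (u : ℝ), (x, u) ∈ W → ∀ a b : TangentSpace (𝓡 n) x, g u x a b = g u x b a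
  pos : ∀ (x : M) (u : ℝ), (x, u) ∈ W → ∀ a : TangentSpace (𝓡 n) x, a ≠ 0 → 0 < g u x a a
  smooth_g : ContMDiffOn ((𝓡 n).prod 𝓘(ℝ, ℝ))
    ((𝓡 n).prod 𝓘(ℝ, Model n →L[ℝ] Model n →L[ℝ] ℝ)) ∞
    (fun p : M × ℝ => TotalSpace.mk' (Model n →L[ℝ] Model n →L[ℝ] ℝ)
      (E := fun x : M => TangentSpace (𝓡 n) x →L[ℝ] TangentSpace (𝓡 n) x →L[ℝ] ℝ)
      p.1 (g p.2 p.1)) W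
  smooth_φ : ContMDiffOn ((𝓡 n).prod 𝓘(ℝ, ℝ)) 𝓘(ℝ, ℝ) ∞ (fun p : M × ℝ => φ p.2 p.1) W
  g_zero : ∀ x : M, g 0 x = g₀.inner x
  φ_zero : ∀ x : M, φ 0 x = φ₀ x
  P_isOInf : TensorIsOInf (fun p : ℝ × M × ℝ =>
    weightedP (ambientModel n) (ambientMetric g) (ambientPotential φ lam) lam p)
  F_isOInf : FunIsOInf (fun p : ℝ × M × ℝ =>
    weightedF (ambientModel n) (ambientMetric g) (ambientPotential φ lam) lam p)

end Ambient

end WeightedAmbient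

end

noncomputable section

namespace WeightedAmbient

/-! ### Inverting a bilinear form. -/

section LinearAlgebra

variable {E : Type*} [NormedAddCommGroup E] [NormedSpace ℝ E]

/-! Write `k(x, u)` for `g_u` in a chart of `M`, and a prime for `∂_u`. The metric `2 du dv + k`
does not depend on `v`, and its `∂_v` row is constant. Hence `∂_v` and `du` are parallel, and the
only new component of the horizontal Christoffel symbols is `Γ^v_{ij} = -k'_{ij}/2`. The curvature
trace has no contribution from the null directions, and the `v`-component of `Γ` is lost when it is
fed back into `Γ`. So the horizontal part of the ambient Ricci tensor is exactly `Ric(g_u)`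
(`localRic_nullExtension`). The term `-v` of the potential picks up `Γ^v`, so the horizontal part of
the ambient Hessian is `∇²φ_u - g'_u/2`.

The ambient equations therefore contain the exact identities `P_ij = (Ric_φ)_ij - g'_ij/2`
(`weightedP_ambient_horiz`) and `F = Δφ - tr(g')/2 - |∇φ|² + 2φ'` (`weightedF_ambient`).

On the other side, `X` has no component along `M`, and `g_u` is annihilated by `∂_v` and `∂_u`. This
gives `L_X g_u = -g'_u` and `L_X φ̃ = -v₁ - φ'`. Consequently `L_X g_u + 2 Ric_φ = 2P` on horizontal
vectors, and `L_X φ̃ + R + Δφ = (tr P - F)/2`, where `tr P` is the `g_u`-trace of the horizontal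
part. The right-hand sides are `O(u^∞)`. For the trace this also uses that the inverse of `g_u`
stays bounded as `u → 0` (`isBigO_metricTrace`). -/

theorem isInvertible_of_pos [FiniteDimensional ℝ E] {A : E →L[ℝ] E →L[ℝ] ℝ}
    (hA : ∀ a, a ≠ 0 → 0 < A a a) : A.IsInvertible := by
  have hinj : Function.Injective (A : E →ₗ[ℝ] E →L[ℝ] ℝ) := by
    rw [← LinearMap.ker_eq_bot, LinearMap.ker_eq_bot']
    intro a ha
    by_contra h
    have h1 := hA a h
    have h2 : A a = 0 := ha
    simp [h2] at h1
  have hdim : Module.finrank ℝ E = Module.finrank ℝ (E →L[ℝ] ℝ) := by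
    rw [← (LinearMap.toContinuousLinearMap (𝕜 := ℝ) (E := E) (F' := ℝ)).finrank_eq]
    exact (Subspace.dual_finrank_eq (K := ℝ) (V := E)).symm
  exact ⟨(LinearEquiv.ofInjectiveOfFinrankEq _ hinj hdim).toContinuousLinearEquiv, by ext; rfl⟩

theorem apply_sharp {A : E →L[ℝ] E →L[ℝ] ℝ} (hA : A.IsInvertible) (l : E →L[ℝ] ℝ) :
    A (sharp A l) = l :=
  hA.self_apply_inverse l

theorem sharp_eq_iff {A : E →L[ℝ] E →L[ℝ] ℝ} (hA : A.IsInvertible) {l : E →L[ℝ] ℝ} {a : E} :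
    sharp A l = a ↔ l = A a :=
  hA.inverse_apply_eq

end LinearAlgebra

/-! ### Linear algebra of `2 du dv + B` on `ℝ × ℝⁿ × ℝ`. -/

section NullExtension

variable {n : ℕ}

@[simp] theorem dv_apply (a : ℝ × Model n × ℝ) : dv n a = a.1 := rfl
@[simp] theorem dx_apply (a : ℝ × Model n × ℝ) : dx n a = a.2.1 := rfl
@[simp] theorem du_apply (a : ℝ × Model n × ℝ) : du n a = a.2.2 := rfl

/-- The inclusion of horizontal vectors. -/
def horiz (n : ℕ) : Model n →L[ℝ] ℝ × Model n × ℝ :=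
  ContinuousLinearMap.inr ℝ ℝ (Model n × ℝ) ∘L ContinuousLinearMap.inl ℝ (Model n) ℝ

@[simp] theorem horiz_apply (a : Model n) : horiz n a = (0, a, 0) := rfl

/-- Pulling back bilinear forms along `dx`, as a continuous linear map. -/
def pullDx (n : ℕ) : (Model n →L[ℝ] Model n →L[ℝ] ℝ) →L[ℝ]
    ((ℝ × Model n × ℝ) →L[ℝ] (ℝ × Model n × ℝ) →L[ℝ] ℝ) :=
  ((ContinuousLinearMap.compL ℝ (ℝ × Model n × ℝ) (Model n)
      ((ℝ × Model n × ℝ) →L[ℝ] ℝ)).flip (dx n)) ∘L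
    (ContinuousLinearMap.compL ℝ (Model n) (Model n →L[ℝ] ℝ) ((ℝ × Model n × ℝ) →L[ℝ] ℝ)
      ((ContinuousLinearMap.compL ℝ (ℝ × Model n × ℝ) (Model n) ℝ).flip (dx n)))

@[simp] theorem pullDx_apply (B : Model n →L[ℝ] Model n →L[ℝ] ℝ) (a b : ℝ × Model n × ℝ) :
    pullDx n B a b = B a.2.1 b.2.1 := rfl

/-- The bilinear form `2 du dv + B`. -/
def nullExtension (B : Model n →L[ℝ] Model n →L[ℝ] ℝ) :
    (ℝ × Model n × ℝ) →L[ℝ] (ℝ × Model n × ℝ) →L[ℝ] ℝ :=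
  (dv n).smulRight (du n) + (du n).smulRight (dv n) + pullDx n B

theorem nullExtension_apply (B : Model n →L[ℝ] Model n →L[ℝ] ℝ) (a b : ℝ × Model n × ℝ) :
    nullExtension B a b = a.1 * b.2.2 + a.2.2 * b.1 + B a.2.1 b.2.1 := by
  simp [nullExtension]

theorem isInvertible_nullExtension {B : Model n →L[ℝ] Model n →L[ℝ] ℝ} (hB : B.IsInvertible) :
    (nullExtension B).IsInvertible := by
  refine ContinuousLinearMap.IsInvertible.of_inverse
    -- The inverse exchanges the two null directions, as `∂_v` is dual to `du`, and inverts `B` on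
    -- the horizontal part.
    (g := (ContinuousLinearMap.apply ℝ ℝ ((0, 0, 1) : ℝ × Model n × ℝ)).prod
      ((sharp B ∘L (ContinuousLinearMap.compL ℝ (Model n) (ℝ × Model n × ℝ) ℝ).flip
        (horiz n)).prod (ContinuousLinearMap.apply ℝ ℝ ((1, 0, 0) : ℝ × Model n × ℝ)))) ?_ ?_
  · ext l
    · simp [nullExtension_apply]
      rfl
    · simp [nullExtension_apply, apply_sharp hB]
    · simp [nullExtension_apply]
  · refine ContinuousLinearMap.ext fun a => ?_
    have h : (nullExtension B a).comp (horiz n) = B a.2.1 := by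
      ext c; simp [nullExtension_apply]
    have h2 : sharp B (B a.2.1) = a.2.1 := (sharp_eq_iff hB).2 rfl
    simp [h, h2]
    simp [nullExtension_apply]

variable {B : Model n →L[ℝ] Model n →L[ℝ] ℝ}

theorem sharp_nullExtension_apply (hB : B.IsInvertible) (l : (ℝ × Model n × ℝ) →L[ℝ] ℝ) :
    sharp (nullExtension B) l = (l (0, 0, 1), sharp B (l ∘L horiz n), l (1, 0, 0)) := by
  rw [sharp_eq_iff (isInvertible_nullExtension hB)]
  ext
  · simp [nullExtension_apply]
    rfl
  · simp [nullExtension_apply, apply_sharp hB]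
  · simp [nullExtension_apply]

/-- The trace of an endomorphism of `ℝ × F × ℝ` is the sum of the traces of its diagonal blocks. -/
theorem trace_eq_blocks (T : (ℝ × Model n × ℝ) →L[ℝ] (ℝ × Model n × ℝ)) :
    LinearMap.trace ℝ (ℝ × Model n × ℝ) (T : (ℝ × Model n × ℝ) →ₗ[ℝ] (ℝ × Model n × ℝ)) =
      (T (1, 0, 0)).1 + LinearMap.trace ℝ (Model n) ((dx n ∘L T ∘L horiz n : Model n →L[ℝ] Model n) :
        Model n →ₗ[ℝ] Model n) + (T (0, 0, 1)).2.2 := by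
  let V : (ℝ × Model n × ℝ) →ₗ[ℝ] ℝ := (dv n : (ℝ × Model n × ℝ) →ₗ[ℝ] ℝ)
  let X : (ℝ × Model n × ℝ) →ₗ[ℝ] Model n := (dx n : (ℝ × Model n × ℝ) →ₗ[ℝ] Model n)
  let U : (ℝ × Model n × ℝ) →ₗ[ℝ] ℝ := (du n : (ℝ × Model n × ℝ) →ₗ[ℝ] ℝ)
  let v : ℝ →ₗ[ℝ] (ℝ × Model n × ℝ) := LinearMap.toSpanSingleton ℝ _ (1, 0, 0)
  let x : Model n →ₗ[ℝ] (ℝ × Model n × ℝ) := (horiz n : Model n →ₗ[ℝ] (ℝ × Model n × ℝ))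
  let u : ℝ →ₗ[ℝ] (ℝ × Model n × ℝ) := LinearMap.toSpanSingleton ℝ _ (0, 0, 1)
  let T' : (ℝ × Model n × ℝ) →ₗ[ℝ] (ℝ × Model n × ℝ) := T
  -- Resolve the identity as a sum of inclusion after projection; cyclicity of the trace then moves
  -- each projection to the front and leaves the diagonal blocks.
  have key : T' = (T' ∘ₗ v) ∘ₗ V + (T' ∘ₗ x) ∘ₗ X + (T' ∘ₗ u) ∘ₗ U := by
    refine LinearMap.ext fun a => ?_
    have : a = v (V a) + x (X a) + u (U a) := by
      obtain ⟨a1, a2, a3⟩ := a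
      simp [v, V, x, X, u, U]
    conv_lhs => rw [this]
    simp only [map_add, LinearMap.add_apply, LinearMap.comp_apply]
  have tr1 : ∀ f : ℝ →ₗ[ℝ] ℝ, LinearMap.trace ℝ ℝ f = f 1 := by
    intro f
    rw [LinearMap.trace_eq_matrix_trace ℝ (Module.Basis.singleton Unit ℝ)]
    simp [Matrix.trace, LinearMap.toMatrix_apply]
  change LinearMap.trace ℝ _ T' = _
  rw [key, map_add, map_add, LinearMap.trace_comp_comm' V, LinearMap.trace_comp_comm' X,
    LinearMap.trace_comp_comm' U, tr1, tr1]
  rw [show V.comp (T'.comp v) 1 = (T (1,0,0)).1 by simp [V, T', v]]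
  rw [show U.comp (T'.comp u) 1 = (T (0,0,1)).2.2 by simp [U, T', u]]
  rfl

/-- The inverse of `2 du dv + B` pairs `v` only with `u`, so the null directions enter a trace only
through the two mixed entries. -/
theorem metricTrace_nullExtension (hB : B.IsInvertible)
    (Q : (ℝ × Model n × ℝ) →L[ℝ] (ℝ × Model n × ℝ) →L[ℝ] ℝ)
    (hQ : Q (1, 0, 0) (0, 0, 1) = 0) (hQ' : Q (0, 0, 1) (1, 0, 0) = 0) :
    metricTrace (nullExtension B) Q = metricTrace B (Q.bilinearComp (horiz n) (horiz n)) := by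
  rw [metricTrace, trace_eq_blocks, metricTrace]
  simp only [ContinuousLinearMap.comp_apply, sharp_nullExtension_apply hB, hQ, hQ', zero_add,
    add_zero]
  congr 2
  ext1 a
  simp [sharp_nullExtension_apply hB]
  rfl

end NullExtension

/-! ### Differentiability of Christoffel symbols, and derivatives along an invariant direction. -/

section Differentiability

variable {E : Type*} [NormedAddCommGroup E] [NormedSpace ℝ E]

theorem differentiableAt_christoffel [CompleteSpace E] {G : E → E →L[ℝ] E →L[ℝ] ℝ} {y : E}
    (hG : ContDiffAt ℝ 2 G y) (hi : (G y).IsInvertible) :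
    DifferentiableAt ℝ (christoffel G) y := by
  have hD : DifferentiableAt ℝ (fderiv ℝ G) y :=
    (hG.fderiv_right (m := 1) (by norm_num)).differentiableAt (by norm_num)
  have hflip : DifferentiableAt ℝ (fun z => (fderiv ℝ G z).flip) y :=
    ((ContinuousLinearMap.flipₗᵢ ℝ E E
      (E →L[ℝ] ℝ)).toContinuousLinearEquiv.differentiableAt).comp y hD
  have h1 : DifferentiableAt ℝ (christoffelFirst G) y :=
    ((hD.add hflip).sub ((differentiableAt_const _).clm_comp hflip)).const_smul (1 / 2 : ℝ)
  have h2 : DifferentiableAt ℝ (fun z => sharp (G z)) y :=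
    (hi.contDiffAt_map_inverse (n := 1)).differentiableAt (by norm_num) |>.comp y
      (hG.differentiableAt (by norm_num))
  exact ((ContinuousLinearMap.differentiableAt _).comp y h2).clm_comp h1

theorem fderiv_apply_apply {E' F F' : Type*} [NormedAddCommGroup E'] [NormedSpace ℝ E']
    [NormedAddCommGroup F] [NormedSpace ℝ F] [NormedAddCommGroup F'] [NormedSpace ℝ F']
    {T : E → E' →L[ℝ] F →L[ℝ] F'} {y : E}
    (hT : DifferentiableAt ℝ T y) (c : E) (a : E') (b : F) :
    fderiv ℝ T y c a b = fderiv ℝ (fun z => T z a b) y c := by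
  have h := ((hT.hasFDerivAt.clm_apply (hasFDerivAt_const a y)).clm_apply
    (hasFDerivAt_const b y)).fderiv
  rw [h]
  simp

/-- Differentiability is not needed: where it fails, `fderiv` is zero by default. -/
theorem fderiv_apply_eq_zero_of_invariant {F : Type*} [NormedAddCommGroup F] [NormedSpace ℝ F]
    {f : E → F} {y e : E} (h : ∀ t : ℝ, f (y + t • e) = f y) : fderiv ℝ f y e = 0 := by
  by_cases hf : DifferentiableAt ℝ f y
  · rw [← hf.lineDeriv_eq_fderiv, lineDeriv]
    simp [h]
  · simp [fderiv_zero_of_not_differentiableAt hf]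

end Differentiability

/-! ### Christoffel symbols and Ricci curvature of `2 du dv + k(x, u)`. -/

section LocalNullExtension

variable {n : ℕ} {k : Model n × ℝ → Model n →L[ℝ] Model n →L[ℝ] ℝ} {y : ℝ × Model n × ℝ}

theorem hasFDerivAt_nullExtension (hk : DifferentiableAt ℝ k y.2) :
    HasFDerivAt (fun z : ℝ × Model n × ℝ => nullExtension (k z.2))
      (pullDx n ∘L fderiv ℝ k y.2 ∘L ContinuousLinearMap.snd ℝ ℝ (Model n × ℝ)) y :=
  (((pullDx n).hasFDerivAt.comp y (hk.hasFDerivAt.comp y hasFDerivAt_snd))).const_add _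

theorem fderiv_nullExtension (hk : DifferentiableAt ℝ k y.2) (a b c : ℝ × Model n × ℝ) :
    fderiv ℝ (fun z : ℝ × Model n × ℝ => nullExtension (k z.2)) y a b c =
      fderiv ℝ k y.2 a.2 b.2.1 c.2.1 := by
  rw [(hasFDerivAt_nullExtension hk).fderiv]
  rfl

theorem contDiffAt_nullExtension (hk : ContDiffAt ℝ 2 k y.2) :
    ContDiffAt ℝ 2 (fun z : ℝ × Model n × ℝ => nullExtension (k z.2)) y :=
  contDiffAt_const.add ((pullDx n).contDiff.contDiffAt.comp y (hk.comp y contDiffAt_snd))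

theorem christoffelFirst_nullExtension (hk : DifferentiableAt ℝ k y.2)
    (a b c : ℝ × Model n × ℝ) :
    christoffelFirst (fun z : ℝ × Model n × ℝ => nullExtension (k z.2)) y a b c =
      (1 / 2 : ℝ) * (fderiv ℝ k y.2 a.2 b.2.1 c.2.1 + fderiv ℝ k y.2 b.2 a.2.1 c.2.1
        - fderiv ℝ k y.2 c.2 a.2.1 b.2.1) := by
  rw [christoffelFirst_apply, fderiv_nullExtension hk, fderiv_nullExtension hk,
    fderiv_nullExtension hk]

theorem fderiv_slice {F : Type*} [NormedAddCommGroup F] [NormedSpace ℝ F]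
    {f : Model n × ℝ → F} {p : Model n × ℝ} (hf : DifferentiableAt ℝ f p) (a : Model n) :
    fderiv ℝ (fun x => f (x, p.2)) p.1 a = fderiv ℝ f p (a, 0) := by
  have h : HasFDerivAt (fun x => f (x, p.2))
      (fderiv ℝ f p ∘L ContinuousLinearMap.inl ℝ (Model n) ℝ) p.1 :=
    HasFDerivAt.comp (g := f) p.1 hf.hasFDerivAt (hasFDerivAt_prodMk_left p.1 p.2)
  rw [h.fderiv]
  rfl

/-- This is the parallelism of `du`: raising an index turns the `u`-component into the first-kind
symbol `Γ(a, b; ∂_v)`, in which every term differentiates either in `v` or a constant entry. -/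
theorem christoffel_nullExtension_snd_snd (hk : DifferentiableAt ℝ k y.2)
    (hi : (k y.2).IsInvertible) (a b : ℝ × Model n × ℝ) :
    (christoffel (fun z : ℝ × Model n × ℝ => nullExtension (k z.2)) y a b).2.2 = 0 := by
  rw [christoffel_apply, sharp_nullExtension_apply hi]
  change christoffelFirst _ y a b (1, 0, 0) = 0
  rw [christoffelFirst_nullExtension hk]
  have : ((0, 0) : Model n × ℝ) = 0 := rfl
  simp [this]

theorem christoffel_nullExtension_left (hk : DifferentiableAt ℝ k y.2)
    (b : ℝ × Model n × ℝ) :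
    christoffel (fun z : ℝ × Model n × ℝ => nullExtension (k z.2)) y (1, 0, 0) b = 0 := by
  have h : christoffelFirst (fun z : ℝ × Model n × ℝ => nullExtension (k z.2)) y (1, 0, 0) b
      = 0 := by
    refine ContinuousLinearMap.ext fun c => ?_
    rw [christoffelFirst_nullExtension hk]
    have : ((0, 0) : Model n × ℝ) = 0 := rfl
    simp [this]
  rw [christoffel_apply, h, map_zero]

theorem christoffel_nullExtension_right (hk : DifferentiableAt ℝ k y.2)
    (a : ℝ × Model n × ℝ) :
    christoffel (fun z : ℝ × Model n × ℝ => nullExtension (k z.2)) y a (1, 0, 0) = 0 := by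
  have h : christoffelFirst (fun z : ℝ × Model n × ℝ => nullExtension (k z.2)) y a (1, 0, 0)
      = 0 := by
    refine ContinuousLinearMap.ext fun c => ?_
    rw [christoffelFirst_nullExtension hk]
    have : ((0, 0) : Model n × ℝ) = 0 := rfl
    simp [this]
  rw [christoffel_apply, h, map_zero]

/-- The `v`-component comes from pairing with `∂_u`: only `-∂_u k(a, b)/2` survives in `Γ(a, b;
∂_u)`. This term is the source of `g'_u` in the ambient equations. -/
theorem christoffel_nullExtension_horiz (hk : DifferentiableAt ℝ k y.2)
    (hi : (k y.2).IsInvertible) (a b : Model n) :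
    christoffel (fun z : ℝ × Model n × ℝ => nullExtension (k z.2)) y (0, a, 0) (0, b, 0) =
      (-(1 / 2) * fderiv ℝ k y.2 (0, 1) a b,
        christoffel (fun x => k (x, y.2.2)) y.2.1 a b, 0) := by
  rw [christoffel_apply, christoffel_apply, sharp_nullExtension_apply hi]
  have h0 : ((0, 0) : Model n × ℝ) = 0 := rfl
  refine Prod.ext ?_ (Prod.ext ?_ ?_)
  · simp [christoffelFirst_nullExtension hk]
  · change sharp _ _ = sharp (k y.2) _
    congr 1
    refine ContinuousLinearMap.ext fun c => ?_
    rw [christoffelFirst_apply, fderiv_slice hk, fderiv_slice hk, fderiv_slice hk]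
    simp [christoffelFirst_nullExtension hk]
  · simp [christoffelFirst_nullExtension hk, h0]

theorem christoffel_translation_invariant (t : ℝ) :
    christoffel (fun z : ℝ × Model n × ℝ => nullExtension (k z.2)) (y + t • (1, 0, 0)) =
      christoffel (fun z : ℝ × Model n × ℝ => nullExtension (k z.2)) y := by
  have h0 : ((0, 0) : Model n × ℝ) = 0 := rfl
  have h : fderiv ℝ (fun z : ℝ × Model n × ℝ => nullExtension (k z.2)) (y + t • (1, 0, 0)) =
      fderiv ℝ (fun z : ℝ × Model n × ℝ => nullExtension (k z.2)) y := by
    rw [← fderiv_comp_add_right]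
    simp [h0]
  simp only [christoffel, christoffelFirst, h]
  simp [h0]

/-- Take the trace of `c ↦ Rm(c, a) b` by blocks. The `v` entry vanishes because `∂_v` is parallel
and nothing depends on `v`; the `u` entry vanishes because `du` is parallel. In the horizontal
block, `Γ^v` could only re-enter through `Γ(c, ∂_v) = 0`, so the curvature of the slice remains. -/
theorem localRic_nullExtension (hk : ContDiffAt ℝ 2 k y.2)
    (hi : ∀ᶠ p in 𝓝 y.2, (k p).IsInvertible) (a b : Model n) :
    localRic (fun z : ℝ × Model n × ℝ => nullExtension (k z.2)) y (0, a, 0) (0, b, 0) =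
      localRic (fun x => k (x, y.2.2)) y.2.1 a b := by
  set G : ℝ × Model n × ℝ → _ := fun z : ℝ × Model n × ℝ => nullExtension (k z.2) with hG
  have hk' : ∀ᶠ z in 𝓝 y, DifferentiableAt ℝ k z.2 :=
    continuousAt_snd.eventually ((hk.eventually (by simp)).mono
      fun p hp => hp.differentiableAt (by norm_num))
  have hi' : ∀ᶠ z in 𝓝 y, (k z.2).IsInvertible := continuousAt_snd.eventually hi
  have hki := hk'.and hi'
  obtain ⟨hky, hiy⟩ := hki.self_of_nhds
  have hdiff : DifferentiableAt ℝ (christoffel G) y :=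
    differentiableAt_christoffel (contDiffAt_nullExtension hk) (isInvertible_nullExtension hiy)
  have hslice : ContDiffAt ℝ 2 (fun x => k (x, y.2.2)) y.2.1 :=
    ContDiffAt.comp (g := k) y.2.1 hk (contDiffAt_id.prodMk contDiffAt_const)
  have hdiff' : DifferentiableAt ℝ (christoffel fun x => k (x, y.2.2)) y.2.1 :=
    differentiableAt_christoffel hslice hiy
  -- The vanishing of `Γ(∂_v, ·)` holds on a neighbourhood of `y`, so it can be differentiated.
  have hv (c : ℝ × Model n × ℝ) : fderiv ℝ (christoffel G) y c (1, 0, 0) = 0 := by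
    refine ContinuousLinearMap.ext fun b => ?_
    rw [fderiv_apply_apply hdiff]
    have : (fun z => christoffel G z (1, 0, 0) b) =ᶠ[𝓝 y] fun _ => 0 :=
      hk'.mono fun z hz => christoffel_nullExtension_left hz b
    rw [this.fderiv_eq]
    simp
  have hu (c a b : ℝ × Model n × ℝ) : (fderiv ℝ (christoffel G) y c a b).2.2 = 0 := by
    rw [fderiv_apply_apply hdiff]
    have hd : DifferentiableAt ℝ (fun z => christoffel G z a b) y :=
      (hdiff.clm_apply (differentiableAt_const a)).clm_apply (differentiableAt_const b)
    have h1 : fderiv ℝ (fun z => du n (christoffel G z a b)) y c =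
        du n (fderiv ℝ (fun z => christoffel G z a b) y c) := by
      exact DFunLike.congr_fun ((du n).hasFDerivAt.comp y hd.hasFDerivAt).fderiv c
    have h2 : (fun z => du n (christoffel G z a b)) =ᶠ[𝓝 y] fun _ => 0 :=
      hki.mono fun z hz => christoffel_nullExtension_snd_snd hz.1 hz.2 a b
    rw [h2.fderiv_eq] at h1
    simpa using h1.symm
  have hx (a b c : Model n) : (fderiv ℝ (christoffel G) y (0, c, 0) (0, a, 0) (0, b, 0)).2.1 =
      fderiv ℝ (christoffel fun x => k (x, y.2.2)) y.2.1 c a b := by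
    rw [fderiv_apply_apply hdiff, fderiv_apply_apply hdiff']
    have hd : DifferentiableAt ℝ (fun z => christoffel G z (0, a, 0) (0, b, 0)) y :=
      (hdiff.clm_apply (differentiableAt_const _)).clm_apply (differentiableAt_const _)
    have hι : HasFDerivAt (fun x : Model n => ((y.1, x, y.2.2) : ℝ × Model n × ℝ))
        (horiz n) y.2.1 :=
      HasFDerivAt.comp (g := fun q : Model n × ℝ => (y.1, q)) y.2.1
        (hasFDerivAt_prodMk_right y.1 (y.2.1, y.2.2)) (hasFDerivAt_prodMk_left y.2.1 y.2.2)
    have h1 := ((dx n).hasFDerivAt.comp y hd.hasFDerivAt).comp y.2.1 hι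
    have h2 : (fun x => christoffel (fun x => k (x, y.2.2)) x a b) =ᶠ[𝓝 y.2.1]
        (((dx n) ∘ fun z => christoffel G z (0, a, 0) (0, b, 0)) ∘
          fun x : Model n => ((y.1, x, y.2.2) : ℝ × Model n × ℝ)) := by
      refine (hι.continuousAt.eventually hki).mono fun x hx => ?_
      simp [hG, christoffel_nullExtension_horiz hx.1 hx.2]
    rw [h2.fderiv_eq, h1.fderiv]
    rfl
  -- This discards the `v`-component `-k'(a, b)/2` from the quadratic terms in `Γ`.
  have hD (c : ℝ × Model n × ℝ) (w : ℝ) (x : Model n) :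
      christoffel G y c (w, x, 0) = christoffel G y c (0, x, 0) := by
    have : ((w, x, 0) : ℝ × Model n × ℝ) = w • (1, 0, 0) + (0, x, 0) := by simp
    rw [this, map_add, map_smul, christoffel_nullExtension_right hky]
    simp
  have hC (a b : Model n) : christoffel G y (0, a, 0) (0, b, 0) = _ :=
    christoffel_nullExtension_horiz hky hiy a b
  rw [localRic_apply, localRic_apply, trace_eq_blocks]
  have e1 : (curvatureEnd G y (0, a, 0) (0, b, 0) (1, 0, 0)) = 0 := by
    have hinv : fderiv ℝ (christoffel G) y (1, 0, 0) = 0 :=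
      fderiv_apply_eq_zero_of_invariant fun t => christoffel_translation_invariant t
    rw [curvatureEnd_apply, hinv, hv, christoffel_nullExtension_left hky,
      christoffel_nullExtension_left hky]
    simp
  have e2 : (curvatureEnd G y (0, a, 0) (0, b, 0) (0, 0, 1)).2.2 = 0 := by
    rw [curvatureEnd_apply]
    have hΓ (c d : ℝ × Model n × ℝ) : (christoffel G y c d).2.2 = 0 :=
      christoffel_nullExtension_snd_snd hky hiy c d
    simp [hu, hΓ]
  rw [e1, e2]
  simp only [Prod.fst_zero, zero_add, add_zero]
  congr 2
  refine ContinuousLinearMap.ext fun c => ?_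
  simp only [ContinuousLinearMap.comp_apply, horiz_apply, dx_apply, curvatureEnd_apply,
    Prod.snd_add, Prod.snd_sub, Prod.fst_add, Prod.fst_sub, hx]
  simp only [hC, hD]

end LocalNullExtension

/-! ### Hessian, Laplacian and gradient of `ψ(x, u) - v`. -/

section LocalHessian

variable {n : ℕ} {k : Model n × ℝ → Model n →L[ℝ] Model n →L[ℝ] ℝ} {ψ : Model n × ℝ → ℝ}
  {y : ℝ × Model n × ℝ}

theorem fderiv_fderiv_slice {p : Model n × ℝ} (hψ : ContDiffAt ℝ 2 ψ p) (a b : Model n) :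
    fderiv ℝ (fderiv ℝ (fun x => ψ (x, p.2))) p.1 a b =
      fderiv ℝ (fderiv ℝ ψ) p (a, 0) (b, 0) := by
  have hD : DifferentiableAt ℝ (fderiv ℝ ψ) p :=
    (hψ.fderiv_right (m := 1) (by norm_num)).differentiableAt (by norm_num)
  have hc : ContinuousAt (fun x : Model n => (x, p.2)) p.1 := by fun_prop
  have h1 : fderiv ℝ (fun x => ψ (x, p.2)) =ᶠ[𝓝 p.1] fun x =>
      (ContinuousLinearMap.compL ℝ (Model n) (Model n × ℝ) ℝ).flip
        (ContinuousLinearMap.inl ℝ (Model n) ℝ) (fderiv ℝ ψ (x, p.2)) := by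
    refine (hc.eventually (hψ.eventually (by simp))).mono fun x hx => ?_
    exact ContinuousLinearMap.ext fun a =>
      fderiv_slice (p := (x, p.2)) (hx.differentiableAt (by norm_num)) a
  have h2 := (((ContinuousLinearMap.compL ℝ (Model n) (Model n × ℝ) ℝ).flip
    (ContinuousLinearMap.inl ℝ (Model n) ℝ)).hasFDerivAt.comp p.1
      (HasFDerivAt.comp (g := fderiv ℝ ψ) p.1 hD.hasFDerivAt
        (hasFDerivAt_prodMk_left p.1 p.2))).fderiv
  rw [h1.fderiv_eq]
  exact DFunLike.congr_fun (DFunLike.congr_fun h2 a) b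

theorem fderiv_sub_fst (hψ : DifferentiableAt ℝ ψ y.2) (a : ℝ × Model n × ℝ) :
    fderiv ℝ (fun z : ℝ × Model n × ℝ => ψ z.2 - z.1) y a = fderiv ℝ ψ y.2 a.2 - a.1 := by
  have h : HasFDerivAt (fun z : ℝ × Model n × ℝ => ψ z.2 - z.1)
      (fderiv ℝ ψ y.2 ∘L ContinuousLinearMap.snd ℝ ℝ (Model n × ℝ) - dv n) y :=
    (hψ.hasFDerivAt.comp y hasFDerivAt_snd).sub hasFDerivAt_fst
  rw [h.fderiv]
  rfl

theorem fderiv_fderiv_sub_fst (hψ : ContDiffAt ℝ 2 ψ y.2) (a b : ℝ × Model n × ℝ) :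
    fderiv ℝ (fderiv ℝ (fun z : ℝ × Model n × ℝ => ψ z.2 - z.1)) y a b =
      fderiv ℝ (fderiv ℝ ψ) y.2 a.2 b.2 := by
  have hD : DifferentiableAt ℝ (fderiv ℝ ψ) y.2 :=
    (hψ.fderiv_right (m := 1) (by norm_num)).differentiableAt (by norm_num)
  have h1 : fderiv ℝ (fun z : ℝ × Model n × ℝ => ψ z.2 - z.1) =ᶠ[𝓝 y] fun z =>
      (ContinuousLinearMap.compL ℝ (ℝ × Model n × ℝ) (Model n × ℝ) ℝ).flip
        (ContinuousLinearMap.snd ℝ ℝ (Model n × ℝ)) (fderiv ℝ ψ z.2) - dv n := by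
    refine (continuousAt_snd.eventually (hψ.eventually (by simp))).mono fun x hx => ?_
    exact ContinuousLinearMap.ext fun a => fderiv_sub_fst (hx.differentiableAt (by norm_num)) a
  have h2 := ((((ContinuousLinearMap.compL ℝ (ℝ × Model n × ℝ) (Model n × ℝ) ℝ).flip
    (ContinuousLinearMap.snd ℝ ℝ (Model n × ℝ))).hasFDerivAt.comp y
      (hD.hasFDerivAt.comp y hasFDerivAt_snd)).sub_const (dv n)).fderiv
  rw [h1.fderiv_eq]
  exact DFunLike.congr_fun (DFunLike.congr_fun h2 a) b

theorem localHess_apply {E : Type*} [NormedAddCommGroup E] [NormedSpace ℝ E]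
    (G : E → E →L[ℝ] E →L[ℝ] ℝ) (f : E → ℝ) (y a b : E) :
    localHess G f y a b = fderiv ℝ (fderiv ℝ f) y a b - fderiv ℝ f y (christoffel G y a b) := by
  simp [localHess]

/-- The second derivatives of `-v` vanish, but its differential sees `Γ^v = -k'/2`; this produces
the correction to the Hessian of the slice. -/
theorem localHess_nullExtension_horiz (hk : DifferentiableAt ℝ k y.2)
    (hi : (k y.2).IsInvertible) (hψ : ContDiffAt ℝ 2 ψ y.2) (a b : Model n) :
    localHess (fun z : ℝ × Model n × ℝ => nullExtension (k z.2))
        (fun z : ℝ × Model n × ℝ => ψ z.2 - z.1) y (0, a, 0) (0, b, 0) =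
      localHess (fun x => k (x, y.2.2)) (fun x => ψ (x, y.2.2)) y.2.1 a b
        - (1 / 2) * fderiv ℝ k y.2 (0, 1) a b := by
  have hd := hψ.differentiableAt (by norm_num)
  rw [localHess_apply, localHess_apply, fderiv_fderiv_sub_fst hψ, fderiv_sub_fst hd,
    christoffel_nullExtension_horiz hk hi, fderiv_fderiv_slice hψ, fderiv_slice hd]
  ring

theorem localHess_nullExtension_left (hk : DifferentiableAt ℝ k y.2)
    (hψ : ContDiffAt ℝ 2 ψ y.2) (b : ℝ × Model n × ℝ) :
    localHess (fun z : ℝ × Model n × ℝ => nullExtension (k z.2))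
        (fun z : ℝ × Model n × ℝ => ψ z.2 - z.1) y (1, 0, 0) b = 0 := by
  rw [localHess_apply, fderiv_fderiv_sub_fst hψ, christoffel_nullExtension_left hk]
  have h0 : ((0, 0) : Model n × ℝ) = 0 := rfl
  simp [h0]

theorem localHess_nullExtension_right (hk : DifferentiableAt ℝ k y.2)
    (hψ : ContDiffAt ℝ 2 ψ y.2) (a : ℝ × Model n × ℝ) :
    localHess (fun z : ℝ × Model n × ℝ => nullExtension (k z.2))
        (fun z : ℝ × Model n × ℝ => ψ z.2 - z.1) y a (1, 0, 0) = 0 := by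
  rw [localHess_apply, fderiv_fderiv_sub_fst hψ, christoffel_nullExtension_right hk]
  have h0 : ((0, 0) : Model n × ℝ) = 0 := rfl
  simp [h0]

theorem metricTrace_sub {E : Type*} [NormedAddCommGroup E] [NormedSpace ℝ E]
    [FiniteDimensional ℝ E] (A B C : E →L[ℝ] E →L[ℝ] ℝ) :
    metricTrace A (B - C) = metricTrace A B - metricTrace A C := by
  simp [metricTrace, ContinuousLinearMap.comp_sub]

theorem metricTrace_add {E : Type*} [NormedAddCommGroup E] [NormedSpace ℝ E]
    [FiniteDimensional ℝ E] (A B C : E →L[ℝ] E →L[ℝ] ℝ) :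
    metricTrace A (B + C) = metricTrace A B + metricTrace A C := by
  simp [metricTrace, ContinuousLinearMap.comp_add]

theorem metricTrace_smul {E : Type*} [NormedAddCommGroup E] [NormedSpace ℝ E]
    [FiniteDimensional ℝ E] (A B : E →L[ℝ] E →L[ℝ] ℝ) (r : ℝ) :
    metricTrace A (r • B) = r * metricTrace A B := by
  simp [metricTrace]

theorem metricTrace_localHess_nullExtension (hk : DifferentiableAt ℝ k y.2)
    (hi : (k y.2).IsInvertible) (hψ : ContDiffAt ℝ 2 ψ y.2) :
    metricTrace (nullExtension (k y.2))
        (localHess (fun z : ℝ × Model n × ℝ => nullExtension (k z.2))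
          (fun z : ℝ × Model n × ℝ => ψ z.2 - z.1) y) =
      metricTrace (k y.2) (localHess (fun x => k (x, y.2.2)) (fun x => ψ (x, y.2.2)) y.2.1)
        - (1 / 2) * metricTrace (k y.2) (fderiv ℝ k y.2 (0, 1)) := by
  rw [metricTrace_nullExtension hi _ (localHess_nullExtension_left hk hψ _)
    (localHess_nullExtension_right hk hψ _), ← metricTrace_smul, ← metricTrace_sub]
  congr 1
  refine ContinuousLinearMap.ext fun a => ContinuousLinearMap.ext fun b => ?_
  exact localHess_nullExtension_horiz hk hi hψ a b

/-- The null part of the inverse metric contributes `2 (∂_v f)(∂_u f)` with `∂_v f = -1` and `∂_u f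
= ∂_u ψ`. -/
theorem localGradSq_nullExtension (hi : (k y.2).IsInvertible) (hψ : DifferentiableAt ℝ ψ y.2) :
    localGradSq (fun z : ℝ × Model n × ℝ => nullExtension (k z.2))
        (fun z : ℝ × Model n × ℝ => ψ z.2 - z.1) y =
      localGradSq (fun x => k (x, y.2.2)) (fun x => ψ (x, y.2.2)) y.2.1
        - 2 * fderiv ℝ ψ y.2 (0, 1) := by
  have h0 : ((0, 0) : Model n × ℝ) = 0 := rfl
  have hs : fderiv ℝ (fun z : ℝ × Model n × ℝ => ψ z.2 - z.1) y ∘L horiz n =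
      fderiv ℝ (fun x => ψ (x, y.2.2)) y.2.1 := by
    refine ContinuousLinearMap.ext fun c => ?_
    rw [fderiv_slice hψ]
    simp [fderiv_sub_fst hψ]
  rw [localGradSq, localGradSq, sharp_nullExtension_apply hi, hs, fderiv_slice hψ,
    fderiv_sub_fst hψ, fderiv_sub_fst hψ, fderiv_sub_fst hψ]
  have hsplit (w : Model n) (t : ℝ) : fderiv ℝ ψ y.2 (w, t) =
      fderiv ℝ ψ y.2 (w, 0) + t * fderiv ℝ ψ y.2 (0, 1) := by
    rw [← smul_eq_mul, ← map_smul, ← map_add]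
    simp
  simp only [h0, map_zero, sub_zero, zero_sub]
  rw [hsplit]
  ring

end LocalHessian

/-! ### Dependence of the local invariants on germs only. -/

section Congruence

variable {E : Type*} [NormedAddCommGroup E] [NormedSpace ℝ E]
  {G G' : E → E →L[ℝ] E →L[ℝ] ℝ} {f f' : E → ℝ} {y : E}

theorem christoffel_congr (hG : G =ᶠ[𝓝 y] G') : christoffel G =ᶠ[𝓝 y] christoffel G' := by
  refine hG.eventuallyEq_nhds.mono fun z hz => ?_
  simp only [christoffel, christoffelFirst, hz.fderiv_eq, hz.self_of_nhds]

theorem localRic_congr [FiniteDimensional ℝ E] (hG : G =ᶠ[𝓝 y] G') :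
    localRic G y = localRic G' y := by
  refine ContinuousLinearMap.ext fun a => ContinuousLinearMap.ext fun b => ?_
  have h := christoffel_congr hG
  simp only [localRic_apply, curvatureEnd, h.fderiv_eq, h.self_of_nhds]

theorem localHess_congr (hG : G =ᶠ[𝓝 y] G') (hf : f =ᶠ[𝓝 y] f') :
    localHess G f y = localHess G' f' y := by
  simp only [localHess, (christoffel_congr hG).self_of_nhds, hf.fderiv_eq, hf.fderiv.fderiv_eq]

theorem localGradSq_congr (hG : G =ᶠ[𝓝 y] G') (hf : f =ᶠ[𝓝 y] f') :
    localGradSq G f y = localGradSq G' f' y := by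
  simp only [localGradSq, hG.self_of_nhds, hf.fderiv_eq]

end Congruence

/-! ### Product charts of `ℝ × M × ℝ` and the ambient tensors in them. -/

section AmbientChart

variable {n : ℕ} {M : Type*} [TopologicalSpace M] [ChartedSpace (Model n) M]

theorem coe_extChartAt_ambient (p : ℝ × M × ℝ) :
    (extChartAt (ambientModel n) p : ℝ × M × ℝ → ℝ × Model n × ℝ) =
      Prod.map id (Prod.map (extChartAt (𝓡 n) p.2.1) id) := by
  simp only [extChartAt_prod, extChartAt_model_space_eq_id]
  rfl

theorem coe_extChartAt_ambient_symm (p : ℝ × M × ℝ) :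
    ((extChartAt (ambientModel n) p).symm : ℝ × Model n × ℝ → ℝ × M × ℝ) =
      Prod.map id (Prod.map (extChartAt (𝓡 n) p.2.1).symm id) := by
  simp only [extChartAt_prod, extChartAt_model_space_eq_id]
  rfl

theorem eventually_mem_target (p : ℝ × M × ℝ) :
    ∀ᶠ y : ℝ × Model n × ℝ in 𝓝 (extChartAt (ambientModel n) p p),
      y.2.1 ∈ (extChartAt (𝓡 n) p.2.1).target := by
  have hc : ContinuousAt (fun y : ℝ × Model n × ℝ => y.2.1) (extChartAt (ambientModel n) p p) := by
    fun_prop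
  refine hc.eventually ?_
  rw [coe_extChartAt_ambient]
  exact extChartAt_target_mem_nhds (I := 𝓡 n) p.2.1

variable [IsManifold (𝓡 n) ∞ M]

theorem mfderiv_extChartAt_ambient_symm (p : ℝ × M × ℝ) {y : ℝ × Model n × ℝ}
    (hy : y.2.1 ∈ (extChartAt (𝓡 n) p.2.1).target) :
    mfderiv 𝓘(ℝ, ℝ × Model n × ℝ) (ambientModel n) (extChartAt (ambientModel n) p).symm y =
      ((ContinuousLinearMap.id ℝ ℝ).prodMap
        ((mfderiv 𝓘(ℝ, Model n) (𝓡 n) (extChartAt (𝓡 n) p.2.1).symm y.2.1 :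
            Model n →L[ℝ] Model n).prodMap (ContinuousLinearMap.id ℝ ℝ)) :
        (ℝ × Model n × ℝ) →L[ℝ] (ℝ × Model n × ℝ)) := by
  have : IsManifold (𝓡 n) 1 M := IsManifold.of_le (n := ∞) (by norm_num)
  have hd : MDifferentiableAt 𝓘(ℝ, Model n) (𝓡 n) (extChartAt (𝓡 n) p.2.1).symm y.2.1 := by
    have := mdifferentiableWithinAt_extChartAt_symm (I := 𝓡 n) hy
    simpa [mdifferentiableWithinAt_univ] using this
  rw [coe_extChartAt_ambient_symm]
  have h1 := mfderiv_prodMap (p := y.2) hd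
    (mdifferentiableAt_id (I := 𝓘(ℝ, ℝ)) (x := y.2.2))
  have h2 := mfderiv_prodMap (p := y) (mdifferentiableAt_id (I := 𝓘(ℝ, ℝ)) (x := y.1))
    (hd.prodMap' (p := y.2) (mdifferentiableAt_id (I := 𝓘(ℝ, ℝ)) (x := y.2.2)))
  rw [h1, mfderiv_id, mfderiv_id] at h2
  have h3 := ((mdifferentiableAt_id (I := 𝓘(ℝ, ℝ)) (x := y.1)).prodMap' (p := y)
    (hd.prodMap' (p := y.2) (mdifferentiableAt_id (I := 𝓘(ℝ, ℝ)) (x := y.2.2)))).hasMFDerivAt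
  rw [h2] at h3
  have h4 : HasMFDerivAt 𝓘(ℝ, ℝ × Model n × ℝ) (ambientModel n)
      (Prod.map id (Prod.map (extChartAt (𝓡 n) p.2.1).symm id)) y _ := h3
  exact h4.mfderiv

theorem mfderiv_extChartAt_ambient (p : ℝ × M × ℝ) {q : ℝ × M × ℝ}
    (hq : q.2.1 ∈ (extChartAt (𝓡 n) p.2.1).source) :
    mfderiv (ambientModel n) 𝓘(ℝ, ℝ × Model n × ℝ) (extChartAt (ambientModel n) p) q =
      ((ContinuousLinearMap.id ℝ ℝ).prodMap
        ((mfderiv (𝓡 n) 𝓘(ℝ, Model n) (extChartAt (𝓡 n) p.2.1) q.2.1 :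
            Model n →L[ℝ] Model n).prodMap (ContinuousLinearMap.id ℝ ℝ)) :
        (ℝ × Model n × ℝ) →L[ℝ] (ℝ × Model n × ℝ)) := by
  have : IsManifold (𝓡 n) 1 M := IsManifold.of_le (n := ∞) (by norm_num)
  have hd : MDifferentiableAt (𝓡 n) 𝓘(ℝ, Model n) (extChartAt (𝓡 n) p.2.1) q.2.1 :=
    mdifferentiableAt_extChartAt (by simpa using hq)
  rw [coe_extChartAt_ambient]
  have h1 := mfderiv_prodMap (p := q.2) hd
    (mdifferentiableAt_id (I := 𝓘(ℝ, ℝ)) (x := q.2.2))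
  have h2 := mfderiv_prodMap (p := q) (mdifferentiableAt_id (I := 𝓘(ℝ, ℝ)) (x := q.1))
    (hd.prodMap' (p := q.2) (mdifferentiableAt_id (I := 𝓘(ℝ, ℝ)) (x := q.2.2)))
  rw [h1, mfderiv_id, mfderiv_id] at h2
  have h3 := ((mdifferentiableAt_id (I := 𝓘(ℝ, ℝ)) (x := q.1)).prodMap' (p := q)
    (hd.prodMap' (p := q.2) (mdifferentiableAt_id (I := 𝓘(ℝ, ℝ)) (x := q.2.2)))).hasMFDerivAt
  rw [h2] at h3
  have h4 : HasMFDerivAt (ambientModel n) 𝓘(ℝ, ℝ × Model n × ℝ)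
      (Prod.map id (Prod.map (extChartAt (𝓡 n) p.2.1) id)) q _ := h3
  exact h4.mfderiv

/-- The coordinate expression of a family of tensors in the chart at `x`, as a function of the
coordinates and of the parameter. -/
def familyInChart (g : ℝ → (x : M) → TangentSpace (𝓡 n) x →L[ℝ] TangentSpace (𝓡 n) x →L[ℝ] ℝ)
    (x : M) (q : Model n × ℝ) : Model n →L[ℝ] Model n →L[ℝ] ℝ :=
  tensorInChart (𝓡 n) (g q.2) x q.1

variable (g : ℝ → (x : M) → TangentSpace (𝓡 n) x →L[ℝ] TangentSpace (𝓡 n) x →L[ℝ] ℝ)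

theorem tensorInChart_horizontal (p : ℝ × M × ℝ) {y : ℝ × Model n × ℝ}
    (hy : y.2.1 ∈ (extChartAt (𝓡 n) p.2.1).target) :
    tensorInChart (ambientModel n) (horizontal g) p y = pullDx n (familyInChart g p.2.1 y.2) := by
  unfold tensorInChart
  rw [mfderiv_extChartAt_ambient_symm p hy, coe_extChartAt_ambient_symm]
  rfl

theorem tensorInChart_ambientMetric (p : ℝ × M × ℝ) {y : ℝ × Model n × ℝ}
    (hy : y.2.1 ∈ (extChartAt (𝓡 n) p.2.1).target) :
    tensorInChart (ambientModel n) (ambientMetric g) p y =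
      nullExtension (familyInChart g p.2.1 y.2) := by
  unfold tensorInChart
  rw [mfderiv_extChartAt_ambient_symm p hy, coe_extChartAt_ambient_symm]
  rfl

theorem vectorInChart_flowField (φ : ℝ → M → ℝ) (lam : ℝ) (p : ℝ × M × ℝ)
    {y : ℝ × Model n × ℝ} (hy : y.2.1 ∈ (extChartAt (𝓡 n) p.2.1).target) :
    vectorInChart (ambientModel n) (flowField g φ lam) p y =
      (vOne g φ lam y.2.2 ((extChartAt (𝓡 n) p.2.1).symm y.2.1), 0, -1) := by
  have hq : ((extChartAt (ambientModel n) p).symm y).2.1 ∈ (extChartAt (𝓡 n) p.2.1).source := by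
    rw [coe_extChartAt_ambient_symm]
    exact (extChartAt (𝓡 n) p.2.1).map_target hy
  unfold vectorInChart
  rw [mfderiv_extChartAt_ambient p hq, coe_extChartAt_ambient_symm]
  refine Prod.ext rfl (Prod.ext ?_ rfl)
  exact map_zero (mfderiv (𝓡 n) 𝓘(ℝ, Model n) (extChartAt (𝓡 n) p.2.1)
    ((extChartAt (𝓡 n) p.2.1).symm y.2.1))

end AmbientChart

/-! ### Smoothness and nondegeneracy of the family in a chart of `M`. -/

section Smoothness

variable {n : ℕ} {M : Type*} [TopologicalSpace M] [ChartedSpace (Model n) M]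

theorem isOpen_chart_preimage {W : Set (M × ℝ)} (hW : IsOpen W) (x : M) :
    IsOpen {q : Model n × ℝ | q.1 ∈ (extChartAt (𝓡 n) x).target ∧
      ((extChartAt (𝓡 n) x).symm q.1, q.2) ∈ W} := by
  have hc : ContinuousOn (fun q : Model n × ℝ => ((extChartAt (𝓡 n) x).symm q.1, q.2))
      (Prod.fst ⁻¹' (extChartAt (𝓡 n) x).target) :=
    ((continuousOn_extChartAt_symm x).comp continuousOn_fst fun _ h => h).prodMk continuousOn_snd
  exact hc.isOpen_inter_preimage ((isOpen_extChartAt_target x).preimage continuous_fst) hW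

variable [IsManifold (𝓡 n) ∞ M]

/-- The derivative of the inverse chart is the inverse of the tangent bundle trivialization at `x`,
which is smooth on its target. -/
theorem contMDiffOn_mfderiv_extChartAt_symm (x : M) (a : Model n) :
    ContMDiffOn 𝓘(ℝ, Model n) ((𝓡 n).prod 𝓘(ℝ, Model n)) ∞
      (fun y => TotalSpace.mk' (Model n) (E := fun x : M => TangentSpace (𝓡 n) x)
        ((extChartAt (𝓡 n) x).symm y)
        (mfderiv 𝓘(ℝ, Model n) (𝓡 n) (extChartAt (𝓡 n) x).symm y a))
      (extChartAt (𝓡 n) x).target := by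
  have : IsManifold (𝓡 n) 1 M := IsManifold.of_le (n := ∞) (by norm_num)
  have : IsManifold (𝓡 n) (∞ + 1) M := by simpa using ‹IsManifold (𝓡 n) ∞ M›
  let e := trivializationAt (Model n) (fun x : M => TangentSpace (𝓡 n) x) x
  have hbase : e.baseSet = (extChartAt (𝓡 n) x).source := by simp [e]
  have h1 : ContMDiffOn 𝓘(ℝ, Model n) ((𝓡 n).prod 𝓘(ℝ, Model n)) ∞
      (fun y => ((extChartAt (𝓡 n) x).symm y, a)) (extChartAt (𝓡 n) x).target :=
    (contMDiffOn_extChartAt_symm x).prodMk contMDiffOn_const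
  have h2 := (e.contMDiffOn_symm (n := ∞) (IB := 𝓡 n)).comp h1 (fun y hy => by
    rw [Set.mem_preimage, e.mem_target, hbase]
    exact (extChartAt (𝓡 n) x).map_target hy)
  refine h2.congr fun y hy => ?_
  have hs := (extChartAt (𝓡 n) x).map_target hy
  have hb : (extChartAt (𝓡 n) x).symm y ∈ e.baseSet := hbase ▸ hs
  have hL := TangentBundle.symmL_trivializationAt (I := 𝓡 n) (x₀ := x)
    (x := (extChartAt (𝓡 n) x).symm y) (by simpa using hs)
  rw [(extChartAt (𝓡 n) x).right_inv hy, ModelWithCorners.range_eq_univ,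
    mfderivWithin_univ] at hL
  have hLa : mfderiv 𝓘(ℝ, Model n) (𝓡 n) (extChartAt (𝓡 n) x).symm y a =
      e.symm ((extChartAt (𝓡 n) x).symm y) a :=
    (DFunLike.congr_fun hL a).symm.trans (e.symmL_apply hb a)
  rw [Function.comp_apply, ← e.mk_symm hb, ← hLa]

variable {g : ℝ → (x : M) → TangentSpace (𝓡 n) x →L[ℝ] TangentSpace (𝓡 n) x →L[ℝ] ℝ}
  {W : Set (M × ℝ)} {x : M} {q : Model n × ℝ}

theorem contMDiffOn_chart_preimage (x : M) :
    ContMDiffOn 𝓘(ℝ, Model n × ℝ) ((𝓡 n).prod 𝓘(ℝ, ℝ)) ∞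
      (fun q : Model n × ℝ => ((extChartAt (𝓡 n) x).symm q.1, q.2))
      {q : Model n × ℝ | q.1 ∈ (extChartAt (𝓡 n) x).target ∧
        ((extChartAt (𝓡 n) x).symm q.1, q.2) ∈ W} :=
  ((contMDiffOn_extChartAt_symm x).comp contDiff_fst.contMDiff.contMDiffOn
    fun _ h => h.1).prodMk contDiff_snd.contMDiff.contMDiffOn

theorem contDiffAt_familyInChart (hW : IsOpen W)
    (hg : ContMDiffOn ((𝓡 n).prod 𝓘(ℝ, ℝ))
      ((𝓡 n).prod 𝓘(ℝ, Model n →L[ℝ] Model n →L[ℝ] ℝ)) ∞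
      (fun p : M × ℝ => TotalSpace.mk' (Model n →L[ℝ] Model n →L[ℝ] ℝ)
        (E := fun x : M => TangentSpace (𝓡 n) x →L[ℝ] TangentSpace (𝓡 n) x →L[ℝ] ℝ)
        p.1 (g p.2 p.1)) W)
    (hq : q.1 ∈ (extChartAt (𝓡 n) x).target) (hqW : ((extChartAt (𝓡 n) x).symm q.1, q.2) ∈ W) :
    ContDiffAt ℝ ∞ (familyInChart g x) q := by
  have : IsManifold (𝓡 n) 1 M := IsManifold.of_le (n := ∞) (by norm_num)
  set U : Set (Model n × ℝ) := {q : Model n × ℝ | q.1 ∈ (extChartAt (𝓡 n) x).target ∧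
      ((extChartAt (𝓡 n) x).symm q.1, q.2) ∈ W} with hU
  suffices h : ContDiffOn ℝ ∞ (familyInChart g x) U from
    h.contDiffAt ((isOpen_chart_preimage hW x).mem_nhds ⟨hq, hqW⟩)
  -- In finite dimension it suffices to test on constant vectors `a`, `b`. Their push-forwards to
  -- `M` are smooth along the inverse chart, and the smooth bundle section is evaluated on them.
  rw [contDiffOn_clm_apply]
  intro a
  rw [contDiffOn_clm_apply]
  intro b
  have hv (a : Model n) : ContMDiffOn 𝓘(ℝ, Model n × ℝ) ((𝓡 n).prod 𝓘(ℝ, Model n)) ∞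
      (fun q : Model n × ℝ => TotalSpace.mk' (Model n) (E := fun x : M => TangentSpace (𝓡 n) x)
        ((extChartAt (𝓡 n) x).symm q.1)
        (mfderiv 𝓘(ℝ, Model n) (𝓡 n) (extChartAt (𝓡 n) x).symm q.1 a)) U :=
    (contMDiffOn_mfderiv_extChartAt_symm x a).comp
      (contDiff_fst.contMDiff.contMDiffOn) fun _ h => h.1
  have hψ := hg.comp (contMDiffOn_chart_preimage (W := W) x) fun _ h => h.2
  intro q hq
  have h3 : ContMDiffWithinAt 𝓘(ℝ, Model n × ℝ) ((𝓡 n).prod 𝓘(ℝ, ℝ)) ∞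
      (fun q : Model n × ℝ => TotalSpace.mk' ℝ (E := Bundle.Trivial M ℝ)
        ((extChartAt (𝓡 n) x).symm q.1) (familyInChart g x q a b)) U q := by
    apply ContMDiffWithinAt.clm_bundle_apply₂ (F₁ := Model n) (F₂ := Model n)
      (E₁ := fun x : M => TangentSpace (𝓡 n) x) (E₂ := fun x : M => TangentSpace (𝓡 n) x)
      (𝕜 := ℝ) (F₃ := ℝ) (E₃ := Bundle.Trivial M ℝ)
      (b := fun q : Model n × ℝ => (extChartAt (𝓡 n) x).symm q.1)
      (ψ := fun q : Model n × ℝ => g q.2 ((extChartAt (𝓡 n) x).symm q.1))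
      (v := fun q => mfderiv 𝓘(ℝ, Model n) (𝓡 n) (extChartAt (𝓡 n) x).symm q.1 a)
      (w := fun q => mfderiv 𝓘(ℝ, Model n) (𝓡 n) (extChartAt (𝓡 n) x).symm q.1 b)
    · exact hψ q hq
    · exact hv a q hq
    · exact hv b q hq
  rw [contMDiffWithinAt_totalSpace] at h3
  exact h3.2.contDiffWithinAt

theorem contDiffAt_function_inChart {φ : ℝ → M → ℝ} (hW : IsOpen W)
    (hφ : ContMDiffOn ((𝓡 n).prod 𝓘(ℝ, ℝ)) 𝓘(ℝ, ℝ) ∞ (fun p : M × ℝ => φ p.2 p.1) W)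
    (hq : q.1 ∈ (extChartAt (𝓡 n) x).target) (hqW : ((extChartAt (𝓡 n) x).symm q.1, q.2) ∈ W) :
    ContDiffAt ℝ ∞ (fun q : Model n × ℝ => φ q.2 ((extChartAt (𝓡 n) x).symm q.1)) q :=
  (hφ.comp (contMDiffOn_chart_preimage (W := W) x) fun _ h => h.2).contDiffOn.contDiffAt
    ((isOpen_chart_preimage hW x).mem_nhds ⟨hq, hqW⟩)

/-- The derivative of the inverse chart is injective, so the pulled back form is still positive
definite, hence nondegenerate. -/
theorem isInvertible_familyInChart (hq : q.1 ∈ (extChartAt (𝓡 n) x).target)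
    (hpos : ∀ a : TangentSpace (𝓡 n) ((extChartAt (𝓡 n) x).symm q.1), a ≠ 0 →
      0 < g q.2 ((extChartAt (𝓡 n) x).symm q.1) a a) :
    (familyInChart g x q).IsInvertible := by
  have : IsManifold (𝓡 n) 1 M := IsManifold.of_le (n := ∞) (by norm_num)
  refine isInvertible_of_pos fun a ha => hpos _ fun h => ha ?_
  have hinv := isInvertible_mfderivWithin_extChartAt_symm (I := 𝓡 n) hq
  rw [ModelWithCorners.range_eq_univ, mfderivWithin_univ] at hinv
  exact hinv.injective (h.trans (map_zero _).symm)

end Smoothness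

/-! ### Decay of metric traces. -/

section Trace

variable {n : ℕ}

theorem metricTrace_eq_sum (A B : Model n →L[ℝ] Model n →L[ℝ] ℝ) :
    metricTrace A B = ∑ i, ∑ j, sharp A (EuclideanSpace.proj j) i *
      B (EuclideanSpace.single i 1) (EuclideanSpace.single j 1) := by
  rw [metricTrace, LinearMap.trace_eq_matrix_trace ℝ (EuclideanSpace.basisFun (Fin n) ℝ).toBasis,
    Matrix.trace]
  refine Finset.sum_congr rfl fun i _ => ?_
  have h : B (EuclideanSpace.single i 1) =
      ∑ j, B (EuclideanSpace.single i 1) (EuclideanSpace.single j 1) •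
        (EuclideanSpace.proj j : Model n →L[ℝ] ℝ) := by
    refine ContinuousLinearMap.ext fun c => ?_
    conv_lhs => rw [← (EuclideanSpace.basisFun (Fin n) ℝ).sum_repr c]
    simp [mul_comm]
  rw [Matrix.diag_apply, LinearMap.toMatrix_apply]
  simp only [OrthonormalBasis.coe_toBasis, EuclideanSpace.basisFun_apply,
    ContinuousLinearMap.coe_coe, ContinuousLinearMap.comp_apply,
    OrthonormalBasis.coe_toBasis_repr_apply, EuclideanSpace.basisFun_repr]
  rw [h, map_sum]
  simp [mul_comm]

/-- Inversion is continuous at an invertible form, so the coefficients `A^{ij}` converge and are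
bounded; the decay of the components of `B` passes to the trace. -/
theorem isBigO_metricTrace {α : Type*} {l : Filter α} {A B : α → Model n →L[ℝ] Model n →L[ℝ] ℝ}
    {A₀ : Model n →L[ℝ] Model n →L[ℝ] ℝ} {f : α → ℝ} (hA : Filter.Tendsto A l (𝓝 A₀))
    (hA₀ : A₀.IsInvertible) (hB : ∀ a b, (fun t => B t a b) =O[l] f) :
    (fun t => metricTrace (A t) (B t)) =O[l] f := by
  have hsharp : Filter.Tendsto (fun t => sharp (A t)) l (𝓝 (sharp A₀)) :=
    ((hA₀.contDiffAt_map_inverse (𝕜 := ℝ) (n := 0)).continuousAt.tendsto).comp hA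
  simp only [metricTrace_eq_sum]
  refine IsBigO.fun_sum fun i _ => IsBigO.fun_sum fun j _ => ?_
  have hcoef : Filter.Tendsto (fun t => sharp (A t) (EuclideanSpace.proj j) i) l
      (𝓝 (sharp A₀ (EuclideanSpace.proj j) i)) :=
    ((EuclideanSpace.proj (𝕜 := ℝ) i).continuous.tendsto _).comp
      (((ContinuousLinearMap.apply ℝ (Model n)
        (EuclideanSpace.proj j : Model n →L[ℝ] ℝ)).continuous.tendsto _).comp hsharp)
  simpa using (hcoef.isBigO_one ℝ).mul (hB (EuclideanSpace.single i 1) (EuclideanSpace.single j 1))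

end Trace

/-! ### The ambient equations and the Lie derivatives in terms of `(g_u, φ_u)`. -/

section AmbientTensors

variable {n : ℕ} {M : Type*} [TopologicalSpace M] [ChartedSpace (Model n) M]

/-- The coordinate expression of a family of functions in the chart at `x`, as a function of the
coordinates and of the parameter. -/
def potentialInChart (φ : ℝ → M → ℝ) (x : M) (q : Model n × ℝ) : ℝ :=
  φ q.2 ((extChartAt (𝓡 n) x).symm q.1)

theorem ambientPotential_comp_extChartAt_symm (φ : ℝ → M → ℝ) (p : ℝ × M × ℝ) :
    ambientPotential φ 0 ∘ (extChartAt (ambientModel n) p).symm =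
      fun z => potentialInChart φ p.2.1 z.2 - z.1 := by
  rw [coe_extChartAt_ambient_symm]
  funext z
  simp [ambientPotential, potentialInChart]

theorem extChartAt_ambient_self (p : ℝ × M × ℝ) :
    extChartAt (ambientModel n) p p = (p.1, extChartAt (𝓡 n) p.2.1 p.2.1, p.2.2) := by
  rw [coe_extChartAt_ambient]
  rfl

variable (g : ℝ → (x : M) → TangentSpace (𝓡 n) x →L[ℝ] TangentSpace (𝓡 n) x →L[ℝ] ℝ) (φ : ℝ → M → ℝ)
  (v : ℝ) (x : M) (u : ℝ)

/-- The `u`-derivative of `g_u` in the chart at `x`. -/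
def dotInChart : Model n →L[ℝ] Model n →L[ℝ] ℝ :=
  fderiv ℝ (familyInChart g x) (extChartAt (𝓡 n) x x, u) (0, 1)

/-- The conditions at the point `(x, u)` under which the formulas for the curvature of
`2 du dv + g_u` and the Hessian of `φ_u - v` hold. -/
structure IsRegularAt : Prop where
  contDiffAt_metric : ContDiffAt ℝ 2 (familyInChart g x) (extChartAt (𝓡 n) x x, u)
  contDiffAt_potential : ContDiffAt ℝ 2 (potentialInChart φ x) (extChartAt (𝓡 n) x x, u)
  isInvertible : ∀ᶠ q in 𝓝 (extChartAt (𝓡 n) x x, u), (familyInChart g x q).IsInvertible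
  continuousAt_potential : ContinuousAt (fun p : M × ℝ => φ p.2 p.1) (x, u)

variable {g φ x u}

/-- `v₁ ∂_v` acts on the term `-v`, and `-∂_u` acts on `φ_u`. -/
theorem lieDerivFun_flowField_ambientPotential (lam : ℝ) (h : IsRegularAt g φ x u) :
    lieDerivFun (ambientModel n) (flowField g φ lam) (ambientPotential φ 0) (v, x, u) =
      -vOne g φ lam u x
        - fderiv ℝ (potentialInChart φ x) (extChartAt (𝓡 n) x x, u) (0, 1) := by
  have hd := h.contDiffAt_potential.differentiableAt (by norm_num)
  have hf : DifferentiableAt ℝ (fun z : ℝ × Model n × ℝ => potentialInChart φ x z.2 - z.1)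
      (v, extChartAt (𝓡 n) x x, u) :=
    (DifferentiableAt.comp (g := potentialInChart φ x) (v, extChartAt (𝓡 n) x x, u) hd
      differentiableAt_snd).sub differentiableAt_fst
  -- `HasMFDerivAt` requires continuity on the manifold itself, apart from differentiability in the
  -- chart.
  have hc : ContinuousAt (ambientPotential φ 0) (v, x, u) := by
    have h1 : ContinuousAt (fun p : ℝ × M × ℝ => φ p.2.2 p.2.1) (v, x, u) :=
      ContinuousAt.comp (g := fun p : M × ℝ => φ p.2 p.1) h.continuousAt_potential
        continuousAt_snd
    have h2 : ambientPotential φ 0 = fun p : ℝ × M × ℝ => φ p.2.2 p.2.1 - p.1 := by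
      funext p
      simp [ambientPotential]
    rw [h2]
    exact h1.sub continuousAt_fst
  have hm : HasMFDerivAt (ambientModel n) 𝓘(ℝ, ℝ) (ambientPotential φ 0) (v, x, u)
      (fderiv ℝ (fun z : ℝ × Model n × ℝ => potentialInChart φ x z.2 - z.1)
        (v, extChartAt (𝓡 n) x x, u)) := by
    refine ⟨hc, ?_⟩
    rw [extChartAt_ambient_self]
    have hw : writtenInExtChartAt (ambientModel n) 𝓘(ℝ, ℝ) (v, x, u) (ambientPotential φ 0) =
        fun z : ℝ × Model n × ℝ => potentialInChart φ x z.2 - z.1 :=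
      ambientPotential_comp_extChartAt_symm φ (v, x, u)
    rw [hw]
    exact hf.hasFDerivAt.hasFDerivWithinAt
  unfold lieDerivFun
  rw [hm.mfderiv]
  refine (fderiv_sub_fst (y := (v, extChartAt (𝓡 n) x x, u)) hd
    (vOne g φ lam u x, 0, -1)).trans ?_
  have hneg : ((0, -1) : Model n × ℝ) = -(0, 1) := by simp
  simp only [hneg, map_neg]
  ring

variable [IsManifold (𝓡 n) ∞ M]

variable (g x u) in
theorem tensorInChart_ambientMetric_eventuallyEq :
    tensorInChart (ambientModel n) (ambientMetric g) (v, x, u) =ᶠ[𝓝 (v, extChartAt (𝓡 n) x x, u)]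
      fun z => nullExtension (familyInChart g x z.2) := by
  have h := eventually_mem_target (n := n) (v, x, u)
  rw [extChartAt_ambient_self] at h
  exact h.mono fun z hz => tensorInChart_ambientMetric g (v, x, u) hz

theorem ric_ambientMetric_horiz (h : IsRegularAt g φ x u) (a b : Model n) :
    (ric (ambientModel n) (ambientMetric g) (v, x, u) :
        (ℝ × Model n × ℝ) →L[ℝ] (ℝ × Model n × ℝ) →L[ℝ] ℝ) (0, a, 0) (0, b, 0) =
      (ric (𝓡 n) (g u) x : Model n →L[ℝ] Model n →L[ℝ] ℝ) a b := by
  unfold ric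
  rw [extChartAt_ambient_self, localRic_congr (tensorInChart_ambientMetric_eventuallyEq g v x u)]
  exact localRic_nullExtension (y := (v, extChartAt (𝓡 n) x x, u)) h.contDiffAt_metric
    h.isInvertible a b

theorem hess_ambientPotential :
    (hess (ambientModel n) (ambientMetric g) (ambientPotential φ 0) (v, x, u) :
        (ℝ × Model n × ℝ) →L[ℝ] (ℝ × Model n × ℝ) →L[ℝ] ℝ) =
      localHess (fun z : ℝ × Model n × ℝ => nullExtension (familyInChart g x z.2))
        (fun z : ℝ × Model n × ℝ => potentialInChart φ x z.2 - z.1)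
        (v, extChartAt (𝓡 n) x x, u) := by
  unfold hess
  rw [extChartAt_ambient_self, ambientPotential_comp_extChartAt_symm,
    localHess_congr (tensorInChart_ambientMetric_eventuallyEq g v x u)
      (Filter.EventuallyEq.refl _ _)]

theorem weightedP_ambient_horiz (h : IsRegularAt g φ x u) (a b : Model n) :
    (weightedP (ambientModel n) (ambientMetric g) (ambientPotential φ 0) 0 (v, x, u) :
        (ℝ × Model n × ℝ) →L[ℝ] (ℝ × Model n × ℝ) →L[ℝ] ℝ) (0, a, 0) (0, b, 0) =
      (weightedRic (𝓡 n) (g u) (φ u) x : Model n →L[ℝ] Model n →L[ℝ] ℝ) a b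
        - (1 / 2) * dotInChart g x u a b := by
  have h1 := ric_ambientMetric_horiz v h a b
  have h2 := localHess_nullExtension_horiz (y := (v, extChartAt (𝓡 n) x x, u))
    (h.contDiffAt_metric.differentiableAt (by norm_num)) h.isInvertible.self_of_nhds
    h.contDiffAt_potential a b
  rw [← hess_ambientPotential] at h2
  have e1 : (weightedP (ambientModel n) (ambientMetric g) (ambientPotential φ 0) 0 (v, x, u) :
        (ℝ × Model n × ℝ) →L[ℝ] (ℝ × Model n × ℝ) →L[ℝ] ℝ) =
      ric (ambientModel n) (ambientMetric g) (v, x, u) +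
        hess (ambientModel n) (ambientMetric g) (ambientPotential φ 0) (v, x, u) := by
    unfold weightedP weightedRic
    rw [zero_smul, sub_zero]
  rw [e1]
  have e2 : (weightedRic (𝓡 n) (g u) (φ u) x : Model n →L[ℝ] Model n →L[ℝ] ℝ) a b =
      (ric (𝓡 n) (g u) x : Model n →L[ℝ] Model n →L[ℝ] ℝ) a b +
        (hess (𝓡 n) (g u) (φ u) x : Model n →L[ℝ] Model n →L[ℝ] ℝ) a b := rfl
  rw [e2]
  refine (congrArg₂ (· + ·) h1 h2).trans ?_
  rw [add_sub_assoc]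
  rfl

theorem weightedF_ambient (h : IsRegularAt g φ x u) :
    weightedF (ambientModel n) (ambientMetric g) (ambientPotential φ 0) 0 (v, x, u) =
      laplacian (𝓡 n) (g u) (φ u) x
        - (1 / 2) * metricTrace (familyInChart g x (extChartAt (𝓡 n) x x, u)) (dotInChart g x u)
        - gradSq (𝓡 n) (g u) (φ u) x
        + 2 * fderiv ℝ (potentialInChart φ x) (extChartAt (𝓡 n) x x, u) (0, 1) := by
  have hd := h.contDiffAt_potential.differentiableAt (by norm_num)
  have h1 : laplacian (ambientModel n) (ambientMetric g) (ambientPotential φ 0) (v, x, u) =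
      laplacian (𝓡 n) (g u) (φ u) x
        - (1 / 2) * metricTrace (familyInChart g x (extChartAt (𝓡 n) x x, u))
          (dotInChart g x u) := by
    unfold laplacian
    rw [hess_ambientPotential, extChartAt_ambient_self,
      (tensorInChart_ambientMetric_eventuallyEq g v x u).self_of_nhds]
    exact metricTrace_localHess_nullExtension (y := (v, extChartAt (𝓡 n) x x, u))
      (h.contDiffAt_metric.differentiableAt (by norm_num)) h.isInvertible.self_of_nhds
      h.contDiffAt_potential
  have h2 : gradSq (ambientModel n) (ambientMetric g) (ambientPotential φ 0) (v, x, u) =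
      gradSq (𝓡 n) (g u) (φ u) x
        - 2 * fderiv ℝ (potentialInChart φ x) (extChartAt (𝓡 n) x x, u) (0, 1) := by
    unfold gradSq
    rw [extChartAt_ambient_self, ambientPotential_comp_extChartAt_symm,
      localGradSq_congr (tensorInChart_ambientMetric_eventuallyEq g v x u)
        (Filter.EventuallyEq.refl _ _)]
    exact localGradSq_nullExtension (y := (v, extChartAt (𝓡 n) x x, u))
      h.isInvertible.self_of_nhds hd
  rw [weightedF, h1, h2]
  ring

/-- The terms with derivatives of `X` see only its component along `M`, which vanishes identically.
What remains is the derivative of the coefficients along `X`, and they depend on `v` not at all. -/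
theorem lieDerivTensor_flowField_horizontal (lam : ℝ) (h : IsRegularAt g φ x u)
    (a b : ℝ × Model n × ℝ) :
    (lieDerivTensor (ambientModel n) (flowField g φ lam) (horizontal g) (v, x, u) :
        (ℝ × Model n × ℝ) →L[ℝ] (ℝ × Model n × ℝ) →L[ℝ] ℝ) a b =
      -dotInChart g x u a.2.1 b.2.1 := by
  have hk := h.contDiffAt_metric.differentiableAt (by norm_num)
  have hT := eventually_mem_target (n := n) (v, x, u)
  rw [extChartAt_ambient_self] at hT
  have hh : tensorInChart (ambientModel n) (horizontal g) (v, x, u)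
      =ᶠ[𝓝 (v, extChartAt (𝓡 n) x x, u)] fun z => pullDx n (familyInChart g x z.2) :=
    hT.mono fun z hz => tensorInChart_horizontal g (v, x, u) hz
  have hX : vectorInChart (ambientModel n) (flowField g φ lam) (v, x, u)
      =ᶠ[𝓝 (v, extChartAt (𝓡 n) x x, u)]
        fun z => (vOne g φ lam z.2.2 ((extChartAt (𝓡 n) x).symm z.2.1), 0, -1) :=
    hT.mono fun z hz => vectorInChart_flowField g φ lam (v, x, u) hz
  have hDX (c : ℝ × Model n × ℝ) :
      (fderiv ℝ (vectorInChart (ambientModel n) (flowField g φ lam) (v, x, u))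
        (v, extChartAt (𝓡 n) x x, u) c).2.1 = 0 := by
    -- This avoids proving that `v₁` is differentiable: otherwise the derivative is the default
    -- value zero, and the claim still holds.
    by_cases hd : DifferentiableAt ℝ
      (vectorInChart (ambientModel n) (flowField g φ lam) (v, x, u)) (v, extChartAt (𝓡 n) x x, u)
    · have h1 := DFunLike.congr_fun ((dx n).hasFDerivAt.comp _ hd.hasFDerivAt).fderiv c
      have h2 : dx n ∘ vectorInChart (ambientModel n) (flowField g φ lam) (v, x, u)
          =ᶠ[𝓝 (v, extChartAt (𝓡 n) x x, u)] fun _ => 0 :=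
        hX.mono fun z hz => by simp [hz]
      rw [h2.fderiv_eq] at h1
      simpa using h1.symm
    · rw [fderiv_zero_of_not_differentiableAt hd]
      rfl
  have hDh : HasFDerivAt (fun z : ℝ × Model n × ℝ => pullDx n (familyInChart g x z.2))
      (pullDx n ∘L fderiv ℝ (familyInChart g x) (extChartAt (𝓡 n) x x, u) ∘L
        ContinuousLinearMap.snd ℝ ℝ (Model n × ℝ)) (v, extChartAt (𝓡 n) x x, u) :=
    (pullDx n).hasFDerivAt.comp (v, extChartAt (𝓡 n) x x, u)
      (HasFDerivAt.comp (g := familyInChart g x) (v, extChartAt (𝓡 n) x x, u)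
        hk.hasFDerivAt hasFDerivAt_snd)
  unfold lieDerivTensor
  rw [extChartAt_ambient_self]
  change fderiv ℝ (tensorInChart (ambientModel n) (horizontal g) (v, x, u))
        (v, extChartAt (𝓡 n) x x, u)
        (vectorInChart (ambientModel n) (flowField g φ lam) (v, x, u)
          (v, extChartAt (𝓡 n) x x, u)) a b
      + tensorInChart (ambientModel n) (horizontal g) (v, x, u) (v, extChartAt (𝓡 n) x x, u)
        (fderiv ℝ (vectorInChart (ambientModel n) (flowField g φ lam) (v, x, u))
          (v, extChartAt (𝓡 n) x x, u) a) b
      + tensorInChart (ambientModel n) (horizontal g) (v, x, u) (v, extChartAt (𝓡 n) x x, u) a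
        (fderiv ℝ (vectorInChart (ambientModel n) (flowField g φ lam) (v, x, u))
          (v, extChartAt (𝓡 n) x x, u) b) = _
  rw [hX.self_of_nhds, hh.self_of_nhds, hh.fderiv_eq, hDh.fderiv]
  simp only [pullDx_apply, hDX]
  have hneg : fderiv ℝ (familyInChart g x) (extChartAt (𝓡 n) x x, u) (0, -1) =
      -dotInChart g x u := by
    rw [dotInChart, ← map_neg]
    simp
  rw [map_zero, map_zero, zero_apply, add_zero, add_zero]
  exact DFunLike.congr_fun (DFunLike.congr_fun hneg a.2.1) b.2.1

end AmbientTensors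

/-! ### Regularity of a normal ambient space near `u = 0`. -/

section Regularity

variable {n : ℕ} {M : Type*} [TopologicalSpace M] [ChartedSpace (Model n) M]
  [IsManifold (𝓡 n) ∞ M]
  {g₀ : ContMDiffRiemannianMetric (𝓡 n) ∞ (Model n) (fun x : M => TangentSpace (𝓡 n) x)}
  {φ₀ : C^∞⟮𝓡 n, M; 𝓘(ℝ, ℝ), ℝ⟯} {lam : ℝ}

theorem NormalAmbientSpace.isRegularAt (A : NormalAmbientSpace g₀ φ₀ lam) {x : M} {u : ℝ}
    (h : (x, u) ∈ A.W) : IsRegularAt A.g A.φ x u := by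
  have hx : extChartAt (𝓡 n) x x ∈ (extChartAt (𝓡 n) x).target := mem_extChartAt_target x
  have hxW : ((extChartAt (𝓡 n) x).symm (extChartAt (𝓡 n) x x), u) ∈ A.W := by
    rwa [extChartAt_to_inv]
  refine ⟨?_, ?_, ?_, ?_⟩
  · exact (contDiffAt_familyInChart (q := (extChartAt (𝓡 n) x x, u)) A.isOpen_W A.smooth_g hx
      hxW).of_le ENat.LEInfty.out
  · exact (contDiffAt_function_inChart (q := (extChartAt (𝓡 n) x x, u)) A.isOpen_W A.smooth_φ hx
      hxW).of_le ENat.LEInfty.out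
  -- A whole neighbourhood is needed because the Ricci tensor differentiates the Christoffel
  -- symbols, which contain the inverse metric.
  · exact Filter.Eventually.mono ((isOpen_chart_preimage A.isOpen_W x).mem_nhds ⟨hx, hxW⟩)
      fun q hq => isInvertible_familyInChart hq.1 (A.pos _ _ hq.2)
  · exact (A.smooth_φ.contMDiffAt (A.isOpen_W.mem_nhds h)).continuousAt

theorem NormalAmbientSpace.eventually_mem_W (A : NormalAmbientSpace g₀ φ₀ lam) (x : M) :
    ∀ᶠ u : ℝ in 𝓝 0, (x, u) ∈ A.W :=
  (Continuous.prodMk_right x).continuousAt.eventually (A.isOpen_W.mem_nhds (A.mem_W x))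

end Regularity

end WeightedAmbient

end

/-! ### The two flow equations. -/

open WeightedAmbient in
theorem theorem1p4 {n : ℕ} {M : Type*} [TopologicalSpace M] [ChartedSpace (Model n) M]
    [IsManifold (𝓡 n) ∞ M]
    (g₀ : ContMDiffRiemannianMetric (𝓡 n) ∞ (Model n) (fun x : M => TangentSpace (𝓡 n) x))
    (φ₀ : C^∞⟮𝓡 n, M; 𝓘(ℝ, ℝ), ℝ⟯) (A : NormalAmbientSpace g₀ φ₀ 0) :
    TensorIsOInf (fun p : ℝ × M × ℝ =>
      lieDerivTensor (ambientModel n) (flowField A.g A.φ 0) (horizontal A.g) p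
        - (-2 : ℝ) • horizontal (fun u x => weightedRic (𝓡 n) (A.g u) (A.φ u) x) p) ∧
    FunIsOInf (fun p : ℝ × M × ℝ =>
      lieDerivFun (ambientModel n) (flowField A.g A.φ 0) (ambientPotential A.φ 0) p
        - -(scal (𝓡 n) (A.g p.2.2) p.2.1
            + laplacian (𝓡 n) (A.g p.2.2) (A.φ p.2.2) p.2.1)) := by

  -- The horizontal components of the ambient tensor equation. The identity behind them holds only
  -- where `(x, u)` lies in `A.W`, which is enough for germs at `u = 0`.
  have hP (v : ℝ) (x : M) (a b : Model n) (m : ℕ) :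
      (fun u : ℝ => (weightedRic (𝓡 n) (A.g u) (A.φ u) x : Model n →L[ℝ] Model n →L[ℝ] ℝ) a b
        - (1 / 2) * dotInChart A.g x u a b) =O[𝓝 0] (fun u : ℝ => u ^ m) :=
    (A.P_isOInf v x (0, a, 0) (0, b, 0) m).congr' ((A.eventually_mem_W x).mono fun u hu =>
      weightedP_ambient_horiz v (A.isRegularAt hu) a b) Filter.EventuallyEq.rfl
  constructor
  · intro v x a b m
    -- The factor is `2` since `-g' + 2 Ric_φ = 2 (Ric_φ - g'/2)`.
    refine ((hP v x a.2.1 b.2.1 m).const_mul_left 2).congr'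
      ((A.eventually_mem_W x).mono fun u hu => ?_) Filter.EventuallyEq.rfl
    have h1 := lieDerivTensor_flowField_horizontal v 0 (A.isRegularAt hu) a b
    have h2 : ((-2 : ℝ) • horizontal (fun u x => weightedRic (𝓡 n) (A.g u) (A.φ u) x) (v, x, u) :
        (ℝ × Model n × ℝ) →L[ℝ] (ℝ × Model n × ℝ) →L[ℝ] ℝ) a b =
        -2 * (weightedRic (𝓡 n) (A.g u) (A.φ u) x : Model n →L[ℝ] Model n →L[ℝ] ℝ)
          a.2.1 b.2.1 := rfl
    refine Eq.trans ?_ (congrArg₂ (· - ·) h1 h2).symm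
    simp only
    ring
  · intro v x m
    have h0 := A.isRegularAt (A.mem_W x)
    have hcont : Filter.Tendsto (fun u : ℝ => familyInChart A.g x (extChartAt (𝓡 n) x x, u))
        (𝓝 0) (𝓝 (familyInChart A.g x (extChartAt (𝓡 n) x x, 0))) :=
      h0.contDiffAt_metric.continuousAt.tendsto.comp
        (Continuous.prodMk_right (extChartAt (𝓡 n) x x)).continuousAt
    let Q : ℝ → Model n →L[ℝ] Model n →L[ℝ] ℝ := fun u => weightedRic (𝓡 n) (A.g u) (A.φ u) x
    have hT := isBigO_metricTrace
      (B := fun u => Q u - (1 / 2 : ℝ) • dotInChart A.g x u) hcont h0.isInvertible.self_of_nhds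
      (fun a b => hP v x a b m)
    -- In `(tr P - F)/2` the terms `tr(g')/2` and `Δφ` cancel, leaving `(R + |∇φ|²)/2 - φ'`, which
    -- equals `-v₁ - φ' + R + Δφ`.
    refine ((hT.sub (A.F_isOInf v x m)).const_mul_left (1 / 2)).congr'
      ((A.eventually_mem_W x).mono fun u hu => ?_) Filter.EventuallyEq.rfl
    have hR : metricTrace (familyInChart A.g x (extChartAt (𝓡 n) x x, u)) (Q u) =
        scal (𝓡 n) (A.g u) x + laplacian (𝓡 n) (A.g u) (A.φ u) x :=
      metricTrace_add _ _ _
    simp only [metricTrace_sub, metricTrace_smul, hR, weightedF_ambient v (A.isRegularAt hu),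
      lieDerivFun_flowField_ambientPotential v 0 (A.isRegularAt hu), vOne, weightedScal]
    ring
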